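/- **Setting.** Fix a probability distribution $\mathcal D$ on $\mathbb R$ supported on $[-b,b]$ with mean $0$ and variance $1$, and fix $\sigma>0$. Consider a sequence of problems in which the dimensions $n$, $p$, $r$ all tend to infinity; all other quantities below, except $\mathcal D,b,\sigma$, may vary along the sequence. Let $\boldsymbol X\in\mathbb R^{n\times p}$ have i.i.d. entries from $\mathcal D$; let $\xi\in\mathbb R^n$ have i.i.d. entries distributed as $\mathcal N(0,\sigma^2)$ conditioned on having absolute value at most $b_n$, where $b_n>0$, $b_n=O(\sigma\sqrt{\log n})$ and $b_n/\sigma-\sqrt{2\log(2n)}\to\infty$; let $\theta_0\in\mathbb R^p$ be deterministic with $\|\theta_0\|_2=1$ and $s_0=|\{j:\theta_{0,j}\ne0\}|$; and let $y=\boldsymbol X\theta_0+\xi$. Let $\boldsymbol R=[\boldsymbol R_1\ \boldsymbol R_2\ \boldsymbol R_3]\in\mathbb R^{r\times(n+p+1)}$ (blocks with $n$, $p$ and $1$ columns) have i.i.d. $\mathcal N(0,1/r)$ entries, with $\boldsymbol X,\xi,\boldsymbol R$ independent. Let $B>0$ be such that almost surely every row of $[\boldsymbol X\ y]$ has $\ell_2$-norm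 at most $B$, let $\epsilon>0$ and $\delta\in(0,1/e)$, and let $w>0$ be given by $$w^2=\frac{4B^2}{\epsilon}\Big(\sqrt{2r\log(4/\delta)}+\log(4/\delta)\Big).$$ Put $[\boldsymbol X^*\ y^*]=\boldsymbol R\begin{bmatrix}\boldsymbol X\ \ y\\ w\boldsymbol I_{p+1}\end{bmatrix}$, that is, $\boldsymbol X^*=\boldsymbol R_1\boldsymbol X+w\boldsymbol R_2$ and $y^*=\boldsymbol R_1y+w\boldsymbol R_3$. For $\lambda>0$ let $\widehat\theta^*$ be any minimizer over $\theta\in\mathbb R^p$ of $\frac1{2n}\|\boldsymbol X^*\theta-y^*\|_2^2+\lambda\|\theta\|_1$. The debiased estimator $\widehat\theta^u=\widehat\theta^*+\frac1n\boldsymbol X^{*\top}(y^*-\boldsymbol X^*\widehat\theta^*)+\frac{w^2}{n}\widehat\theta^*$ decomposes as $\widehat\theta^u=\theta_0+\frac1n\boldsymbol X^{*\top}\boldsymbol R_1\xi+\Delta$ with bias term $$\Delta=\Big(\tfrac1n\boldsymbol X^\top\boldsymbol X-\boldsymbol I_p\Big)(\theta_0-\widehat\theta^*)+\tfrac1n[\boldsymbol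 X^\top\ w\boldsymbol I_p\ \mathbf 0](\boldsymbol R^\top\boldsymbol R-\boldsymbol I_{n+p+1})\begin{bmatrix}\boldsymbol X(\theta_0-\widehat\theta^*)\\-w\widehat\theta^*\\ w\end{bmatrix}.$$ **Theorem.** There exists an absolute constant $C_\lambda>0$ such that, in the above setting with $$\lambda=C_\lambda\,\sigma\max\Big\{\sqrt{\tfrac{\log p}{n}},\sqrt{\tfrac{(\log p)^3}{r}}\Big\},\quad \rho_n^2=\frac{n+r+1}{nr}+\frac{w^2}{nr},\quad \phi_w=1+\frac{w^2}{n},\quad \kappa_n=2\lambda\sqrt{s_0}+\frac{w^2}{n},$$ if all of the following conditions hold, 1. $\dfrac{\kappa_n^2}{\lambda^2\phi_w}=o\Big(\sqrt{\frac{n}{\log p}}\cdot\min\Big\{1,\sqrt{\frac rn},\frac{\sqrt{rn}}{w^2}\Big\}\Big)$, 2. $\sqrt{s_0}=O\left(\dfrac{\max\{\frac1{\sqrt n},\frac{\log p}{\sqrt r}\}}{\max\{\frac{w\log p}{\sqrt{nr}},\frac{w^2}{n}\sqrt{\frac{\log p}{r}}\}}\right)$, 3. $\dfrac{1}{\sigma\rho_n}\sqrt{s_0}=o\Big(\min\Big\{\frac{n}{w^2}\sqrt{\frac{r}{\log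 p}},\frac{\sqrt{nr}}{w\log p}\Big\}\Big)$, 4. $\dfrac{1}{\sigma\rho_n}\dfrac{4\kappa_n^2}{\lambda\phi_w}=o\Big(\min\Big\{\sqrt{\frac n{\log p}},\sqrt{\frac r{\log p}},\frac n{w^2}\sqrt{\frac r{\log p}},\frac{\sqrt{nr}}{w\log p}\Big\}\Big)$, then $\|\Delta\|_\infty=o_p(\sigma\rho_n)$, i.e. $\mathbb P\big(\|\Delta\|_\infty/(\sigma\rho_n)>\eta\big)\to0$ for every $\eta>0$. -/

import Mathlib

open MeasureTheory ProbabilityTheory Filter Asymptotics Topology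
open scoped Matrix NNReal ENNReal

namespace PrivateLasso

/-- The law `𝒟` of the design entries: a probability measure supported on `[-b, b]`,
with mean zero and variance one. -/
structure IsDesignLaw (𝒟 : Measure ℝ) (b : ℝ) : Prop where
  isProbabilityMeasure : IsProbabilityMeasure 𝒟
  support : 𝒟 (Set.Icc (-b) b)ᶜ = 0
  mean : ∫ x, x ∂𝒟 = 0
  variance : Var[fun x => x; 𝒟] = 1

/-- The truncated Gaussian `𝒯𝒩(0, σ², τ)`: the law of `g ∼ 𝒩(0, σ²)` conditioned on `|g| ≤ τ`. -/
noncomputable def truncGaussian (σ τ : ℝ) : Measure ℝ :=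
  (gaussianReal 0 (σ ^ 2).toNNReal)[|Set.Icc (-τ) τ]

/-- The `n + p + 1` columns of the projection matrix `R = [R₁ R₂ R₃]`. -/
abbrev Cols (n p : ℕ) : Type := Fin n ⊕ (Fin p ⊕ Fin 1)

/-- All the scalar random variables of the model: the entries of `X`, `ξ` and `R`. -/
def entries {Ω : Type*} {n p r : ℕ} (X : Ω → Matrix (Fin n) (Fin p) ℝ) (ξ : Ω → Fin n → ℝ)
    (R : Ω → Matrix (Fin r) (Cols n p) ℝ) :
    (Fin n × Fin p) ⊕ (Fin n ⊕ (Fin r × Cols n p)) → Ω → ℝ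
  | .inl ij, ω => X ω ij.1 ij.2
  | .inr (.inl i), ω => ξ ω i
  | .inr (.inr ai), ω => R ω ai.1 ai.2

/-- The randomness of the model: the entries of `X` are drawn from `𝒟`, those of `ξ` from the
truncated Gaussian, those of `R` from `𝒩(0, 1/r)`, all of them mutually independent. -/
structure IsSample {Ω : Type*} [MeasurableSpace Ω] (P : Measure Ω) {n p r : ℕ}
    (𝒟 : Measure ℝ) (σ τ : ℝ) (X : Ω → Matrix (Fin n) (Fin p) ℝ) (ξ : Ω → Fin n → ℝ)
    (R : Ω → Matrix (Fin r) (Cols n p) ℝ) : Prop where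
  law_design : ∀ i j, HasLaw (fun ω => X ω i j) 𝒟 P
  law_noise : ∀ i, HasLaw (fun ω => ξ ω i) (truncGaussian σ τ) P
  law_proj : ∀ a c, HasLaw (fun ω => R ω a c) (gaussianReal 0 (r : ℝ≥0)⁻¹) P
  indep : iIndepFun (entries X ξ R) P

/-- The linear model `y = X θ₀ + ξ`. -/
def response {n p : ℕ} (X : Matrix (Fin n) (Fin p) ℝ) (θ₀ : Fin p → ℝ) (ξ : Fin n → ℝ) :
    Fin n → ℝ :=
  X *ᵥ θ₀ + ξ

/-- The sparsity level `s₀ = #{j : θ₀ⱼ ≠ 0}`. -/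
noncomputable def sparsity {p : ℕ} (θ₀ : Fin p → ℝ) : ℕ := {j | θ₀ j ≠ 0}.ncard

/-- `B` bounds the Euclidean norm of every row of `[X y]`. -/
def RowBound {n p : ℕ} (X : Matrix (Fin n) (Fin p) ℝ) (y : Fin n → ℝ) (B : ℝ) : Prop :=
  ∀ i, √(∑ j, X i j ^ 2 + y i ^ 2) ≤ B

/-- The privacy parameter `w > 0` with
`w² = (4 B² / ε) (√(2 r log (4/δ)) + log (4/δ))`. -/
noncomputable def privacyW (B ε δ : ℝ) (r : ℕ) : ℝ :=
  √(4 * B ^ 2 / ε * (√(2 * r * Real.log (4 / δ)) + Real.log (4 / δ)))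

/-- The released matrix `[X* y*] = R · [[X y]; w I]`. -/
def release {n p r : ℕ} (R : Matrix (Fin r) (Cols n p) ℝ) (X : Matrix (Fin n) (Fin p) ℝ)
    (y : Fin n → ℝ) (w : ℝ) : Matrix (Fin r) (Fin p ⊕ Fin 1) ℝ :=
  R * Matrix.fromRows (Matrix.fromCols X (Matrix.replicateCol (Fin 1) y))
    (w • (1 : Matrix (Fin p ⊕ Fin 1) (Fin p ⊕ Fin 1) ℝ))

/-- The private design `X*`. -/
def privX {n p r : ℕ} (R : Matrix (Fin r) (Cols n p) ℝ) (X : Matrix (Fin n) (Fin p) ℝ)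
    (y : Fin n → ℝ) (w : ℝ) : Matrix (Fin r) (Fin p) ℝ :=
  (release R X y w).toCols₁

/-- The private response `y*`. -/
def privY {n p r : ℕ} (R : Matrix (Fin r) (Cols n p) ℝ) (X : Matrix (Fin n) (Fin p) ℝ)
    (y : Fin n → ℝ) (w : ℝ) : Fin r → ℝ :=
  fun a => (release R X y w).toCols₂ a 0

/-- The objective `(1/2n) ‖A θ - z‖₂² + lam ‖θ‖₁`; `n` is the original sample size, not the
number `r` of rows of `A`. -/
noncomputable def lassoObj {p r : ℕ} (n : ℕ) (A : Matrix (Fin r) (Fin p) ℝ) (z : Fin r → ℝ)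
    (lam : ℝ) (θ : Fin p → ℝ) : ℝ :=
  1 / (2 * n) * ‖WithLp.toLp 2 (A *ᵥ θ - z)‖ ^ 2 + lam * ‖WithLp.toLp 1 θ‖

/-- `θhat` is a private Lasso estimate: a minimizer of the private Lasso objective. -/
def IsPrivateLasso {n p r : ℕ} (R : Matrix (Fin r) (Cols n p) ℝ) (X : Matrix (Fin n) (Fin p) ℝ)
    (y : Fin n → ℝ) (w lam : ℝ) (θhat : Fin p → ℝ) : Prop :=
  ∀ θ, lassoObj n (privX R X y w) (privY R X y w) lam θhat ≤
    lassoObj n (privX R X y w) (privY R X y w) lam θ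

/-- The bias term
`Δ = (XᵀX/n - I)(θ₀ - θhat) + (1/n) [Xᵀ wI 0] (RᵀR - I) [X(θ₀ - θhat); -w θhat; w]`. -/
noncomputable def bias {n p r : ℕ} (R : Matrix (Fin r) (Cols n p) ℝ)
    (X : Matrix (Fin n) (Fin p) ℝ) (w : ℝ) (θ₀ θhat : Fin p → ℝ) : Fin p → ℝ :=
  ((1 / (n : ℝ)) • (Xᵀ * X) - 1) *ᵥ (θ₀ - θhat) +
    (1 / (n : ℝ)) •
      ((Matrix.fromCols Xᵀ (Matrix.fromCols (w • (1 : Matrix (Fin p) (Fin p) ℝ))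
          (0 : Matrix (Fin p) (Fin 1) ℝ)) * (Rᵀ * R - 1)) *ᵥ
        Sum.elim (X *ᵥ (θ₀ - θhat)) (Sum.elim (-(w • θhat)) (fun _ => w)))

/-- `ρₙ`, with `ρₙ² = (n + r + 1)/(n r) + w²/(n r)`. -/
noncomputable def rho (n r : ℕ) (w : ℝ) : ℝ :=
  √(((n : ℝ) + r + 1) / (n * r) + w ^ 2 / (n * r))

/-- `φ_w = 1 + w²/n`. -/
noncomputable def phi (n : ℕ) (w : ℝ) : ℝ := 1 + w ^ 2 / n

/-- `κₙ = 2 lam √s₀ + w²/n`. -/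
noncomputable def kappa (n s₀ : ℕ) (lam w : ℝ) : ℝ := 2 * lam * √(s₀ : ℝ) + w ^ 2 / n

/-- `max {√(log p / n), √((log p)³ / r)}`, the rate of the regularization parameter. -/
noncomputable def lamRate (n p r : ℕ) : ℝ :=
  max √(Real.log p / n) √(Real.log p ^ 3 / r)

end PrivateLasso

/-! Put Z = [X; wI; 0], q = [ξ; -wθ₀; w], t = w²/n and l = log p. Then X* = RZ and y* - X*θ₀ = Rq,
so only inner products of projected vectors enter. Apart from R, these vectors (the columns of Z, q,
and q with ξ replaced by 0) depend only on (X, ξ), which is independent of R. With probability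
tending to one, R preserves all the required inner products up to a relative error of order √(l/r),
while XᵀX/n is entrywise within order √(l/n) of I. `IsRegular` collects these bounds and two bounds
on the noise; `measureReal_not_isRegular_le` gives its probability. Everything else is
deterministic.

On regular data X*ᵀX*/n is entrywise close to (1 + t)I, and X*ᵀ(y* - X*θ₀)/n is close to Zᵀq/n, that
is to -tθ₀ plus a small term. The drift -tθ₀ is not small in sup norm, but θ₀ is a unit vector, so
by Cauchy-Schwarz it costs only t times the ℓ₂ error. This is why κ = 2λ√s₀ + t, and
`lasso_l1_error_le` bounds the ℓ₁ error by 2κ²/(λφ).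

The estimator depends on R, so concentration cannot be applied to it directly. `bias_apply` writes Δ
as a matrix with small entries acting on θ₀ - θhat, plus a shift free of θhat. Hölder's inequality
handles the first part and near-preservation the second (`IsRegular.norm_bias_le`).

These constants involve an upper bound K for t. Conditions 2 and 4 together supply one
(`noise_level_le`); conditions 1, 3 and 4 then make the error terms small relative to σρ. -/

namespace PrivateLasso

/-! ### Independence: fibres of events and rows of random matrices -/

/-- If the fibres of an event all have probability at most `c`, so has the event. -/
lemma measureReal_prodMk_mem_le {Ω α β : Type*} [MeasurableSpace Ω] [MeasurableSpace α]
    [MeasurableSpace β] {P : Measure Ω} [IsProbabilityMeasure P] {U : Ω → α} {V : Ω → β}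
    (hU : AEMeasurable U P) (hV : AEMeasurable V P) (hUV : IndepFun U V P)
    {S : Set (α × β)} (hS : MeasurableSet S) {c : ℝ}
    (h : ∀ u, P.real {ω | (u, V ω) ∈ S} ≤ c) :
    P.real {ω | (U ω, V ω) ∈ S} ≤ c := by
  have hc : 0 ≤ c := by
    obtain ⟨ω⟩ := P.nonempty_of_neZero
    exact measureReal_nonneg.trans (h (U ω))
  have : IsProbabilityMeasure (P.map U) := Measure.isProbabilityMeasure_map hU
  have : IsProbabilityMeasure (P.map V) := Measure.isProbabilityMeasure_map hV
  have key : P {ω | (U ω, V ω) ∈ S} ≤ ENNReal.ofReal c := by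
    have h1 : P {ω | (U ω, V ω) ∈ S} = (P.map (fun ω => (U ω, V ω))) S := by
      rw [Measure.map_apply_of_aemeasurable (hU.prodMk hV) hS]; rfl
    rw [h1, (indepFun_iff_map_prod_eq_prod_map_map hU hV).1 hUV, Measure.prod_apply hS]
    calc ∫⁻ u, (P.map V) (Prod.mk u ⁻¹' S) ∂(P.map U)
        ≤ ∫⁻ _, ENNReal.ofReal c ∂(P.map U) := by
          refine lintegral_mono fun u => ?_
          rw [Measure.map_apply_of_aemeasurable hV (measurable_prodMk_left hS)]
          have := h u
          rw [← ENNReal.ofReal_toReal (measure_ne_top P (V ⁻¹' (Prod.mk u ⁻¹' S)))]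
          exact ENNReal.ofReal_le_ofReal this
      _ = ENNReal.ofReal c := by simp
  exact ENNReal.toReal_le_of_le_ofReal hc key

/-- The rows of a matrix with independent entries are independent. -/
lemma iIndepFun_rows {Ω ι κ : Type*} [MeasurableSpace Ω] [Fintype ι] [Fintype κ]
    {P : Measure Ω} {f : ι → κ → Ω → ℝ} (hf : ∀ i j, AEMeasurable (f i j) P)
    (h : iIndepFun (fun q : ι × κ => f q.1 q.2) P) :
    iIndepFun (fun i ω j => f i j ω) P := by
  have := h.isProbabilityMeasure
  have : ∀ i j, IsProbabilityMeasure (P.map (f i j)) :=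
    fun i j ↦ Measure.isProbabilityMeasure_map (hf i j)
  have : ∀ i, IsProbabilityMeasure (P.map fun ω j => f i j ω) :=
    fun i ↦ Measure.isProbabilityMeasure_map (aemeasurable_pi_lambda _ (hf i))
  have hs : iIndepFun (fun q : (_ : ι) × κ => f q.1 q.2) P :=
    h.precomp (Equiv.sigmaEquivProd ι κ).injective
  have hrow : ∀ i, iIndepFun (fun j => f i j) P := fun i =>
    h.precomp (g := fun j => (i, j)) fun a b hab => by simpa using hab
  have e : (fun ω i j => f i j ω) =
      (MeasurableEquiv.piCurry (fun (_ : ι) (_ : κ) => ℝ)) ∘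
        (fun ω (q : (_ : ι) × κ) => f q.1 q.2 ω) := by
    ext; simp [Sigma.curry]
  rw [iIndepFun_iff_map_fun_eq_pi_map (fun i => aemeasurable_pi_lambda _ (hf i))]
  rw [e, ← AEMeasurable.map_map_of_aemeasurable
      (f := fun ω (q : (_ : ι) × κ) => f q.1 q.2 ω) (by fun_prop)
      (aemeasurable_pi_lambda _ fun q => hf q.1 q.2),
    hs.map_fun_eq_pi_map (f := fun (q : (_ : ι) × κ) => f q.1 q.2) fun q => hf q.1 q.2,
    ← Measure.infinitePi_eq_pi,
    Measure.infinitePi_map_piCurry (fun i j ↦ P.map (f i j)), ← Measure.infinitePi_eq_pi]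
  congr 1
  ext1 i
  rw [(hrow i).map_fun_eq_pi_map (hf i), Measure.infinitePi_eq_pi]

/-! ### Gaussian projections: chi-square concentration and inner products -/

/-- Linear combinations of independent centered Gaussians. -/
lemma hasLaw_sum_mul_gaussian {Ω κ : Type*} [MeasurableSpace Ω]
    {P : Measure Ω} {g : κ → Ω → ℝ} {v : ℝ≥0} (hg : ∀ c, HasLaw (g c) (gaussianReal 0 v) P)
    (h : iIndepFun g P) (u : κ → ℝ) (s : Finset κ) :
    HasLaw (fun ω => ∑ c ∈ s, g c ω * u c)
      (gaussianReal 0 ((∑ c ∈ s, u c ^ 2).toNNReal * v)) P := by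
  classical
  have := h.isProbabilityMeasure
  have hm : ∀ c, AEMeasurable (g c) P := fun c => (hg c).aemeasurable
  induction s using Finset.induction_on with
  | empty =>
    refine ⟨by fun_prop, ?_⟩
    simp
  | insert a s ha ih =>
    have hu : iIndepFun (fun c ω => g c ω * u c) P :=
      h.comp (fun c x => x * u c) fun c => by fun_prop
    have hind := (hu.indepFun_finsetSum_of_notMem₀ (fun c => by fun_prop) ha).symm
    have e : (∑ j ∈ s, fun ω => g j ω * u j) = fun ω => ∑ c ∈ s, g c ω * u c := by
      ext ω; simp
    rw [e] at hind
    have h1 := gaussianReal_mul_const (hg a) (u a)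
    refine ⟨by fun_prop, ?_⟩
    have h2 := gaussianReal_add_gaussianReal_of_indepFun hind h1.map_eq ih.map_eq
    have e2 : (fun ω => ∑ c ∈ insert a s, g c ω * u c) =
        (fun ω => g a ω * u a) + fun ω => ∑ c ∈ s, g c ω * u c := by
      ext ω; simp [Finset.sum_insert ha]
    rw [e2, h2]
    congr 1
    · simp
    · rw [Finset.sum_insert ha, Real.toNNReal_add (sq_nonneg _) (Finset.sum_nonneg fun _ _ => sq_nonneg _),
        add_mul]
      congr 2
      ext; simp [sq_nonneg]

/-- The moment generating function of the square of a centered Gaussian; where it is infinite,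
both sides vanish. -/
lemma integral_exp_sq_gaussian {v : ℝ≥0} (hv : v ≠ 0) (l : ℝ) :
    ∫ x, Real.exp (l * x ^ 2) ∂(gaussianReal 0 v) = (√(1 - 2 * l * v))⁻¹ := by
  have hv' : (0 : ℝ) < v := by positivity
  have e : ∀ x : ℝ, gaussianPDFReal 0 v x * Real.exp (l * x ^ 2) =
      (√(2 * Real.pi * v))⁻¹ * Real.exp (-((1 - 2 * l * v) / (2 * v)) * x ^ 2) := by
    intro x
    rw [gaussianPDFReal, mul_assoc, ← Real.exp_add]
    congr 2
    field_simp
    ring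
  rw [integral_gaussianReal_eq_integral_smul hv]
  simp only [smul_eq_mul, e]
  rw [integral_const_mul, integral_gaussian, ← Real.sqrt_inv, ← Real.sqrt_inv,
    ← Real.sqrt_mul (by positivity)]
  congr 1
  field_simp

lemma inv_sqrt_one_sub_le {x : ℝ} (hx : |x| ≤ 1 / 3) :
    (√(1 - x))⁻¹ ≤ Real.exp (x / 2 + x ^ 2 / 2) := by
  have h := abs_le.1 hx
  have hp : 0 < 1 - x := by linarith
  have hl := (abs_le.1 (Real.abs_log_sub_add_sum_range_le (x := x) (by linarith) 2)).1
  have hd : |x| ^ 3 / (1 - |x|) ≤ x ^ 2 / 2 := by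
    rw [div_le_iff₀ (by linarith), ← sq_abs x]
    nlinarith [abs_nonneg x, sq_nonneg |x|]
  simp [Finset.sum_range_succ] at hl
  norm_num at hl
  rw [← Real.exp_log hp, ← Real.exp_half, ← Real.exp_neg]
  apply Real.exp_le_exp.2
  linarith

/-- Two-sided concentration of a normalized chi-square variable. -/
lemma measureReal_sum_sq_gaussian_le {Ω : Type*} [MeasurableSpace Ω] {P : Measure Ω} {r : ℕ}
    (hr : 0 < r) {Y : Fin r → Ω → ℝ} (hY : ∀ a, HasLaw (Y a) (gaussianReal 0 (r : ℝ≥0)⁻¹) P)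
    (h : iIndepFun Y P) {s : ℝ} (hs0 : 0 ≤ s) (hs1 : s ≤ 1 / 2) :
    P.real {ω | s ≤ |∑ a, Y a ω ^ 2 - 1|} ≤ 2 * Real.exp (-(r * s ^ 2 / 8)) := by
  have := h.isProbabilityMeasure
  have hr' : (0 : ℝ) < r := by exact_mod_cast hr
  have hv : (r : ℝ≥0)⁻¹ ≠ 0 := by positivity
  have hm : ∀ a, AEMeasurable (Y a) P := fun a => (hY a).aemeasurable
  -- The argument of the mgf is rx/2 so that, with variance 1/r, the closed formula depends on x
  -- alone.
  have key : ∀ x : ℝ, |x| ≤ 1 / 3 →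
      Integrable (fun ω => Real.exp (r * x / 2 * ∑ a, Y a ω ^ 2)) P ∧
      mgf (fun ω => ∑ a, Y a ω ^ 2) P (r * x / 2) ≤ Real.exp (r * (x / 2 + x ^ 2 / 2)) := by
    intro x hx
    have hx' := abs_le.1 hx
    have e0 : 2 * (r * x / 2) * (((r : ℝ≥0)⁻¹ : ℝ≥0) : ℝ) = x := by
      push_cast; field_simp
    have he := integral_exp_sq_gaussian hv (r * x / 2)
    rw [e0] at he
    have hind : iIndepFun (fun a ω => Y a ω ^ 2) P := h.comp (fun _ x => x ^ 2) fun _ => by fun_prop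
    have es : (fun ω => ∑ a, Y a ω ^ 2) = ∑ a, fun ω => Y a ω ^ 2 := by ext; simp
    have hpos : 0 < (√(1 - x))⁻¹ := inv_pos.2 (Real.sqrt_pos.2 (by linarith))
    have hmgf : mgf (fun ω => ∑ a, Y a ω ^ 2) P (r * x / 2) = (√(1 - x))⁻¹ ^ r := by
      rw [es, hind.mgf_sum₀ (fun a => by fun_prop)]
      have : ∀ a, mgf (fun ω => Y a ω ^ 2) P (r * x / 2) = (√(1 - x))⁻¹ := fun a => by
        rw [← he, ← (hY a).map_eq, integral_map (hm a) (by fun_prop)]; rfl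
      simp only [this, Finset.prod_const, Finset.card_univ, Fintype.card_fin]
    constructor
    -- Without integrability `mgf` takes the default value 0, but the closed formula is positive; so
    -- integrability follows from the formula.
    · by_contra hni
      rw [mgf_undef hni] at hmgf
      exact absurd hmgf (pow_pos hpos r).ne
    · rw [hmgf, Real.exp_nat_mul]
      gcongr
      exact inv_sqrt_one_sub_le hx
  have up : P.real {ω | 1 + s ≤ ∑ a, Y a ω ^ 2} ≤ Real.exp (-(r * s ^ 2 / 8)) := by
    -- The choice x = s/2 minimizes the Chernoff exponent r(-xs/2 + x²/2), with value -rs²/8; the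
    -- lower tail uses -s/2.
    obtain ⟨h1, h2⟩ := key (s / 2) (by rw [abs_of_nonneg (by linarith)]; linarith)
    refine (measure_ge_le_exp_mul_mgf (1 + s) (by positivity) h1).trans ?_
    refine (mul_le_mul_of_nonneg_left h2 (Real.exp_pos _).le).trans ?_
    rw [← Real.exp_add]
    apply Real.exp_le_exp.2
    apply le_of_eq; ring
  have lo : P.real {ω | ∑ a, Y a ω ^ 2 ≤ 1 - s} ≤ Real.exp (-(r * s ^ 2 / 8)) := by
    obtain ⟨h1, h2⟩ := key (-(s / 2)) (by rw [abs_neg, abs_of_nonneg (by linarith)]; linarith)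
    refine (measure_le_le_exp_mul_mgf (1 - s) (t := r * -(s / 2) / 2) ?_ h1).trans ?_
    · have : 0 ≤ r * s := by positivity
      linarith
    refine (mul_le_mul_of_nonneg_left h2 (Real.exp_pos _).le).trans ?_
    rw [← Real.exp_add]
    apply Real.exp_le_exp.2
    apply le_of_eq; ring
  calc P.real {ω | s ≤ |∑ a, Y a ω ^ 2 - 1|}
      ≤ P.real ({ω | 1 + s ≤ ∑ a, Y a ω ^ 2} ∪ {ω | ∑ a, Y a ω ^ 2 ≤ 1 - s}) := by
        apply measureReal_mono _ (measure_ne_top _ _)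
        intro ω hω
        rcases le_abs.1 (show s ≤ |∑ a, Y a ω ^ 2 - 1| from hω) with h | h
        · left; rw [Set.mem_ofPred_eq]; linarith
        · right; rw [Set.mem_ofPred_eq]; linarith
    _ ≤ _ := (measureReal_union_le _ _).trans (by linarith)

/-- Concentration of the squared norm of a Gaussian projection. -/
lemma measureReal_sq_norm_projection_le {Ω κ : Type*} [MeasurableSpace Ω] [Fintype κ]
    {P : Measure Ω} {r : ℕ} (hr : 0 < r) {R : Ω → Matrix (Fin r) κ ℝ}
    (hR : ∀ a c, HasLaw (fun ω => R ω a c) (gaussianReal 0 (r : ℝ≥0)⁻¹) P)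
    (h : iIndepFun (fun (q : Fin r × κ) ω => R ω q.1 q.2) P) {s : ℝ} (hs0 : 0 ≤ s)
    (hs1 : s ≤ 1 / 2) (u : κ → ℝ) :
    P.real {ω | s * (u ⬝ᵥ u) < |(R ω *ᵥ u) ⬝ᵥ (R ω *ᵥ u) - u ⬝ᵥ u|} ≤
      2 * Real.exp (-(r * s ^ 2 / 8)) := by
  have := h.isProbabilityMeasure
  have hm : ∀ a c, AEMeasurable (fun ω => R ω a c) P := fun a c => (hR a c).aemeasurable
  have huu : ∀ z : κ → ℝ, z ⬝ᵥ z = ∑ c, z c ^ 2 := fun z => by simp [dotProduct, sq]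
  rcases eq_or_ne u 0 with rfl | hu
  · simp; positivity
  have hpos : 0 < u ⬝ᵥ u := by
    rw [huu]
    obtain ⟨c, hc⟩ := Function.ne_iff.1 hu
    exact lt_of_lt_of_le (by have : u c ≠ 0 := hc; positivity)
      (Finset.single_le_sum (f := fun c => u c ^ 2) (fun _ _ => sq_nonneg _) (Finset.mem_univ c))
  set m := √(u ⬝ᵥ u) with hmdef
  have hm0 : 0 < m := Real.sqrt_pos.2 hpos
  have hmm : m ^ 2 = u ⬝ᵥ u := Real.sq_sqrt hpos.le
  let Y : Fin r → Ω → ℝ := fun a ω => ∑ c, R ω a c * (u c / m)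
  have hYl : ∀ a, HasLaw (Y a) (gaussianReal 0 (r : ℝ≥0)⁻¹) P := fun a => by
    have := hasLaw_sum_mul_gaussian (hR a) (h.precomp (g := fun c => (a, c))
      fun x y hxy => by simpa using hxy) (fun c => u c / m) Finset.univ
    have e : (∑ c, (u c / m) ^ 2) = 1 := by
      simp only [div_pow, ← Finset.sum_div, ← huu, hmm]
      exact div_self hpos.ne'
    rw [e] at this
    simpa using this
  have hYi : iIndepFun Y P :=
    (iIndepFun_rows (f := fun a c ω => R ω a c) hm h).comp
      (fun _ z => ∑ c, z c * (u c / m)) fun _ => by fun_prop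
  refine le_trans (measureReal_mono ?_ (measure_ne_top _ _))
    (measureReal_sum_sq_gaussian_le hr hYl hYi hs0 hs1)
  intro ω hω
  have e : (R ω *ᵥ u) ⬝ᵥ (R ω *ᵥ u) = (u ⬝ᵥ u) * ∑ a, Y a ω ^ 2 := by
    have : ∀ a, Y a ω = (R ω *ᵥ u) a / m := fun a => by
      simp only [Y, Matrix.mulVec, dotProduct, Finset.sum_div, mul_div_assoc]
    simp only [this, div_pow, hmm, ← Finset.sum_div]
    rw [mul_div_cancel₀ _ hpos.ne']
    simp [dotProduct, sq]
  have hω' : s * (u ⬝ᵥ u) < |(R ω *ᵥ u) ⬝ᵥ (R ω *ᵥ u) - u ⬝ᵥ u| := hω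
  rw [e, show (u ⬝ᵥ u) * ∑ a, Y a ω ^ 2 - u ⬝ᵥ u = (u ⬝ᵥ u) * (∑ a, Y a ω ^ 2 - 1) by ring,
    abs_mul, abs_of_pos hpos, mul_comm] at hω'
  exact (lt_of_mul_lt_mul_left hω' hpos.le).le

/-- A Gaussian projection nearly preserves inner products. -/
lemma measureReal_inner_projection_le {Ω κ : Type*} [MeasurableSpace Ω] [Fintype κ]
    {P : Measure Ω} {r : ℕ} (hr : 0 < r) {R : Ω → Matrix (Fin r) κ ℝ}
    (hR : ∀ a c, HasLaw (fun ω => R ω a c) (gaussianReal 0 (r : ℝ≥0)⁻¹) P)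
    (h : iIndepFun (fun (q : Fin r × κ) ω => R ω q.1 q.2) P) {s : ℝ} (hs0 : 0 ≤ s)
    (hs1 : s ≤ 1 / 2) (u v : κ → ℝ) :
    P.real {ω | s * (√(u ⬝ᵥ u) * √(v ⬝ᵥ v)) < |(R ω *ᵥ u) ⬝ᵥ (R ω *ᵥ v) - u ⬝ᵥ v|} ≤
      4 * Real.exp (-(r * s ^ 2 / 8)) := by
  have := h.isProbabilityMeasure
  have hnn : ∀ z : κ → ℝ, 0 ≤ z ⬝ᵥ z := fun z =>
    Finset.sum_nonneg fun _ _ => mul_self_nonneg _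
  rcases eq_or_ne u 0 with rfl | hu
  · simp; positivity
  rcases eq_or_ne v 0 with rfl | hv
  · simp; positivity
  have hpu : 0 < √(u ⬝ᵥ u) := Real.sqrt_pos.2 ((hnn u).lt_of_ne fun h =>
    hu (dotProduct_self_eq_zero.1 h.symm))
  have hpv : 0 < √(v ⬝ᵥ v) := Real.sqrt_pos.2 ((hnn v).lt_of_ne fun h =>
    hv (dotProduct_self_eq_zero.1 h.symm))
  set x := √(u ⬝ᵥ u) with hx
  set y := √(v ⬝ᵥ v) with hy
  have hxx : x ^ 2 = u ⬝ᵥ u := Real.sq_sqrt (hnn u)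
  have hyy : y ^ 2 = v ⬝ᵥ v := Real.sq_sqrt (hnn v)
  -- Polarization, after rescaling u and v to the common norm xy: the squared norms of the sum and
  -- difference add up to 4x²y², which makes the error proportional to the product of the norms.
  have h1 := measureReal_sq_norm_projection_le hr hR h hs0 hs1 (y • u + x • v)
  have h2 := measureReal_sq_norm_projection_le hr hR h hs0 hs1 (y • u - x • v)
  refine le_trans (measureReal_mono ?_ (measure_ne_top _ _))
    ((measureReal_union_le _ _).trans ((add_le_add h1 h2).trans (by linarith)))
  intro ω hω
  by_contra hcon
  simp only [Set.mem_union, Set.mem_ofPred_eq, not_or, not_lt] at hcon hω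
  obtain ⟨c1, c2⟩ := hcon
  have hvu : v ⬝ᵥ u = u ⬝ᵥ v := dotProduct_comm _ _
  have hRvu : (R ω *ᵥ v) ⬝ᵥ (R ω *ᵥ u) = (R ω *ᵥ u) ⬝ᵥ (R ω *ᵥ v) := dotProduct_comm _ _
  simp only [Matrix.mulVec_add, Matrix.mulVec_sub, Matrix.mulVec_smul, dotProduct_add,
    add_dotProduct, dotProduct_sub, sub_dotProduct, smul_dotProduct, dotProduct_smul,
    smul_eq_mul, hvu, hRvu, ← hxx, ← hyy] at c1 c2
  rw [abs_le] at c1 c2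
  have hxy : 0 < x * y := mul_pos hpu hpv
  have : |x * y * ((R ω *ᵥ u) ⬝ᵥ (R ω *ᵥ v) - u ⬝ᵥ v)| ≤ x * y * (s * (x * y)) := by
    rw [abs_le]
    constructor <;> nlinarith [c1.1, c1.2, c2.1, c2.2]
  rw [abs_mul, abs_of_pos hxy] at this
  exact absurd hω (not_lt.2 (le_of_mul_le_mul_left this hxy))

/-! ### Truncated Gaussian noise -/

/-- Conditioning on a sublevel set of `f` does not increase the mean of `f`. -/
lemma integral_cond_le {α : Type*} [MeasurableSpace α] {μ : Measure α} [IsProbabilityMeasure μ]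
    {A : Set α} (hA : MeasurableSet A) (hA0 : μ A ≠ 0) {f : α → ℝ} (hf : Integrable f μ) {c : ℝ}
    (h1 : ∀ x ∈ A, f x ≤ c) (h2 : ∀ x ∉ A, c ≤ f x) :
    ∫ x, f x ∂(μ[|A]) ≤ ∫ x, f x ∂μ := by
  have hpos : 0 < μ.real A := ENNReal.toReal_pos hA0 (measure_ne_top _ _)
  have e : ∫ x, f x ∂(μ[|A]) = (μ.real A)⁻¹ * ∫ x in A, f x ∂μ := by
    rw [ProbabilityTheory.cond, integral_smul_measure, ENNReal.toReal_inv, smul_eq_mul]; rfl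
  have hsplit := integral_add_compl hA hf
  have hc : μ.real Aᶜ = 1 - μ.real A := probReal_compl_eq_one_sub hA
  have i1 : ∫ x in A, f x ∂μ ≤ c * μ.real A := by
    have := setIntegral_mono_on hf.integrableOn (integrable_const c).integrableOn hA h1
    simpa [mul_comm] using this
  have i2 : c * μ.real Aᶜ ≤ ∫ x in Aᶜ, f x ∂μ := by
    have := setIntegral_mono_on (integrable_const c).integrableOn hf.integrableOn hA.compl h2
    simpa [mul_comm] using this
  have hle : 0 ≤ 1 - μ.real A := by linarith [measureReal_le_one (μ := μ) (s := A)]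
  -- The claim rearranges to μ(Aᶜ)∫_A f ≤ μ(A)∫_{Aᶜ} f, and c μ(A) μ(Aᶜ) lies between the two sides.
  rw [e, inv_mul_le_iff₀ hpos, ← hsplit]
  rw [hc] at i2
  nlinarith [mul_le_mul_of_nonneg_left i1 hle, mul_le_mul_of_nonneg_left i2 hpos.le]

lemma gaussian_Icc_ne_zero {σ τ : ℝ} (hσ : 0 < σ) (hτ : 0 < τ) :
    gaussianReal 0 (σ ^ 2).toNNReal (Set.Icc (-τ) τ) ≠ 0 := by
  intro h
  have hv : (σ ^ 2).toNNReal ≠ 0 := by simpa using hσ.ne'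
  have := gaussianReal_absolutelyContinuous' 0 hv h
  simp [Real.volume_Icc] at this
  linarith

lemma truncGaussian_map_neg (σ τ : ℝ) :
    (truncGaussian σ τ).map (fun x => -x) = truncGaussian σ τ := by
  have h := (MeasurableEquiv.neg ℝ).restrict_map (gaussianReal 0 (σ ^ 2).toNNReal) (Set.Icc (-τ) τ)
  have e1 : (gaussianReal 0 (σ ^ 2).toNNReal).map (MeasurableEquiv.neg ℝ) =
      gaussianReal 0 (σ ^ 2).toNNReal := by
    simpa using gaussianReal_map_neg (μ := 0) (v := (σ ^ 2).toNNReal)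
  have e2 : (MeasurableEquiv.neg ℝ) ⁻¹' (Set.Icc (-τ) τ) = Set.Icc (-τ) τ := by
    ext x; simp [and_comm]
  rw [e1, e2] at h
  rw [truncGaussian, ProbabilityTheory.cond, Measure.map_smul]
  congr 1
  exact h.symm

lemma integrable_of_gaussian {σ τ : ℝ} (hσ : 0 < σ) (hτ : 0 < τ) {f : ℝ → ℝ}
    (hf : Integrable f (gaussianReal 0 (σ ^ 2).toNNReal)) : Integrable f (truncGaussian σ τ) :=
  (hf.restrict).smul_measure (ENNReal.inv_ne_top.2 (gaussian_Icc_ne_zero hσ hτ))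

/-- The truncated Gaussian is sub-Gaussian with the variance proxy of the Gaussian. -/
lemma hasSubgaussianMGF_truncGaussian {σ τ : ℝ} (hσ : 0 < σ) (hτ : 0 < τ) :
    HasSubgaussianMGF (fun x => x) (σ ^ 2).toNNReal (truncGaussian σ τ) := by
  have hg : ∀ t : ℝ, Integrable (fun x => Real.exp (t * x)) (gaussianReal 0 (σ ^ 2).toNNReal) :=
    fun t => integrable_exp_mul_gaussianReal t
  have hi : ∀ t : ℝ, Integrable (fun x => Real.exp (t * x)) (truncGaussian σ τ) :=
    fun t => integrable_of_gaussian hσ hτ (hg t)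
  refine ⟨hi, fun t => ?_⟩
  have hgc : Integrable (fun x => Real.cosh (t * x)) (gaussianReal 0 (σ ^ 2).toNNReal) := by
    simp only [Real.cosh_eq, ← neg_mul]
    exact ((hg t).add (hg (-t))).div_const 2
  -- Symmetry of the law replaces exp by cosh, which is monotone in |x|; the truncation interval is
  -- then a sublevel set and `integral_cond_le` applies.
  have e1 : mgf (fun x => x) (truncGaussian σ τ) t = ∫ x, Real.cosh (t * x) ∂(truncGaussian σ τ) := by
    have hsym : ∫ x, Real.exp (-t * x) ∂(truncGaussian σ τ) =
        ∫ x, Real.exp (t * x) ∂(truncGaussian σ τ) := by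
      conv_rhs => rw [← truncGaussian_map_neg, integral_map (by fun_prop) (by fun_prop)]
      simp
    simp only [Real.cosh_eq, ← neg_mul]
    rw [integral_div, integral_add (hi t) (hi (-t)), hsym]
    simp [mgf]
  have e2 : ∫ x, Real.cosh (t * x) ∂(gaussianReal 0 (σ ^ 2).toNNReal) =
      Real.exp ((σ ^ 2).toNNReal * t ^ 2 / 2) := by
    simp only [Real.cosh_eq, ← neg_mul]
    rw [integral_div, integral_add (hg t) (hg (-t))]
    have h := fun t => congrFun (mgf_fun_id_gaussianReal (μ := 0) (v := (σ ^ 2).toNNReal)) t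
    simp only [mgf] at h
    rw [h t, h (-t)]
    simp
  rw [e1, ← e2]
  refine integral_cond_le measurableSet_Icc (gaussian_Icc_ne_zero hσ hτ) hgc
    (c := Real.cosh (t * τ)) (fun x hx => ?_) fun x hx => ?_
  · rw [Real.cosh_le_cosh, abs_mul, abs_mul, abs_of_pos hτ]
    exact mul_le_mul_of_nonneg_left (abs_le.2 hx) (abs_nonneg _)
  · rw [Real.cosh_le_cosh, abs_mul, abs_mul, abs_of_pos hτ]
    have : τ ≤ |x| := by
      by_contra hlt
      exact hx (abs_le.1 (not_le.1 hlt).le)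
    exact mul_le_mul_of_nonneg_left this (abs_nonneg _)

/-- The truncation interval is a sublevel set of x², so `integral_cond_le` compares with the
untruncated variance. -/
lemma integral_sq_truncGaussian_le {σ τ : ℝ} (hσ : 0 < σ) (hτ : 0 < τ) :
    ∫ x, x ^ 2 ∂(truncGaussian σ τ) ≤ σ ^ 2 := by
  have hint : Integrable (fun x : ℝ => x ^ 2) (gaussianReal 0 (σ ^ 2).toNNReal) :=
    (memLp_id_gaussianReal (μ := 0) (v := (σ ^ 2).toNNReal) 2).integrable_sq
  have hvar : ∫ x, x ^ 2 ∂(gaussianReal 0 (σ ^ 2).toNNReal) = σ ^ 2 := by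
    have h := variance_fun_id_gaussianReal (μ := 0) (v := (σ ^ 2).toNNReal)
    rw [variance_of_integral_eq_zero (by fun_prop) (by simp)] at h
    rw [h, Real.coe_toNNReal _ (sq_nonneg σ)]
  rw [← hvar]
  refine integral_cond_le measurableSet_Icc (gaussian_Icc_ne_zero hσ hτ) hint
    (c := τ ^ 2) (fun x hx => ?_) fun x hx => ?_
  · exact sq_le_sq' hx.1 hx.2
  · have : τ ≤ |x| := by
      by_contra hlt
      exact hx (abs_le.1 (not_le.1 hlt).le)
    rw [← sq_abs x]
    gcongr

/-- Two-sided Hoeffding bound for sums of independent sub-Gaussian variables. -/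
lemma measureReal_abs_sum_ge_le {Ω ι : Type*} [MeasurableSpace Ω] [Fintype ι] {P : Measure Ω}
    {Y : ι → Ω → ℝ} (h : iIndepFun Y P) {c : ι → ℝ≥0}
    (hY : ∀ i, HasSubgaussianMGF (Y i) (c i) P) {ε : ℝ} (hε : 0 ≤ ε) :
    P.real {ω | ε ≤ |∑ i, Y i ω|} ≤ 2 * Real.exp (-ε ^ 2 / (2 * ∑ i, (c i : ℝ))) := by
  have := h.isProbabilityMeasure
  have hs := HasSubgaussianMGF.sum_of_iIndepFun h (s := Finset.univ) fun i _ => hY i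
  have h1 := hs.measure_ge_le hε
  have h2 := hs.neg.measure_ge_le hε
  push_cast at h1 h2
  refine le_trans (measureReal_mono ?_ (measure_ne_top _ _))
    ((measureReal_union_le _ _).trans ((add_le_add h1 h2).trans (by linarith)))
  intro ω hω
  rcases le_abs.1 (show ε ≤ |∑ i, Y i ω| from hω) with h | h
  · left; exact h
  · right; rw [Set.mem_ofPred_eq]; simpa using h

/-- Sub-Gaussian bound for the noise along a fixed direction. -/
lemma measureReal_dotProduct_noise_le {Ω : Type*} [MeasurableSpace Ω] {P : Measure Ω} {n : ℕ}
    {σ τ : ℝ} (hσ : 0 < σ) (hτ : 0 < τ) {ξ : Ω → Fin n → ℝ}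
    (hξ : ∀ i, HasLaw (fun ω => ξ ω i) (truncGaussian σ τ) P)
    (h : iIndepFun (fun i ω => ξ ω i) P) {l : ℝ} (hl : 0 ≤ l) (x : Fin n → ℝ) :
    P.real {ω | 2 * σ * √l * √(x ⬝ᵥ x) < |x ⬝ᵥ ξ ω|} ≤ 2 * Real.exp (-(2 * l)) := by
  have := h.isProbabilityMeasure
  have hnn : 0 ≤ x ⬝ᵥ x := Finset.sum_nonneg fun _ _ => mul_self_nonneg _
  rcases eq_or_ne x 0 with rfl | hx
  · simp; positivity
  have hpos : 0 < x ⬝ᵥ x := hnn.lt_of_ne fun h => hx (dotProduct_self_eq_zero.1 h.symm)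
  have hsub : ∀ i, HasSubgaussianMGF (fun ω => ξ ω i) (σ ^ 2).toNNReal P := fun i =>
    HasSubgaussianMGF.of_map (X := fun x => x) (hξ i).aemeasurable
      ((hξ i).map_eq ▸ hasSubgaussianMGF_truncGaussian hσ hτ)
  have key := measureReal_abs_sum_ge_le (Y := fun i ω => x i * ξ ω i)
    (h.comp (fun i y => x i * y) fun i => by fun_prop)
    (c := fun i => (x i ^ 2).toNNReal * (σ ^ 2).toNNReal)
    (fun i => by
      rw [Real.toNNReal_of_nonneg (sq_nonneg (x i))]; exact (hsub i).const_mul (x i))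
    (ε := 2 * σ * √l * √(x ⬝ᵥ x)) (by positivity)
  refine le_trans (measureReal_mono ?_ (measure_ne_top _ _)) (key.trans (le_of_eq ?_))
  · intro ω hω
    exact le_of_lt (show 2 * σ * √l * √(x ⬝ᵥ x) < |x ⬝ᵥ ξ ω| from hω)
  · congr 2
    have : (∑ i, ((x i ^ 2).toNNReal * (σ ^ 2).toNNReal : ℝ)) = (x ⬝ᵥ x) * σ ^ 2 := by
      simp [dotProduct, Finset.sum_mul, sq, mul_self_nonneg]
    simp only [NNReal.coe_mul]
    rw [this, mul_pow, mul_pow, mul_pow, Real.sq_sqrt hl, Real.sq_sqrt hnn]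
    field_simp

/-- Markov bound for the squared norm of the noise. -/
lemma measureReal_sq_norm_noise_le {Ω : Type*} [MeasurableSpace Ω] {P : Measure Ω}
    [IsProbabilityMeasure P] {n : ℕ} (hn : 0 < n)
    {σ τ : ℝ} (hσ : 0 < σ) (hτ : 0 < τ) {ξ : Ω → Fin n → ℝ}
    (hξ : ∀ i, HasLaw (fun ω => ξ ω i) (truncGaussian σ τ) P) {l : ℝ} (hl : 0 < l) :
    P.real {ω | n * σ ^ 2 * l < ξ ω ⬝ᵥ ξ ω} ≤ 1 / l := by
  have hint : Integrable (fun x : ℝ => x ^ 2) (truncGaussian σ τ) :=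
    integrable_of_gaussian hσ hτ
      (memLp_id_gaussianReal (μ := 0) (v := (σ ^ 2).toNNReal) 2).integrable_sq
  have hi : ∀ i, Integrable (fun ω => ξ ω i ^ 2) P := fun i => by
    rw [← (hξ i).map_eq] at hint
    exact hint.comp_aemeasurable (hξ i).aemeasurable
  have he : ∀ i, ∫ ω, ξ ω i ^ 2 ∂P ≤ σ ^ 2 := fun i => by
    have := integral_sq_truncGaussian_le hσ hτ
    rwa [← (hξ i).map_eq, integral_map (hξ i).aemeasurable (by fun_prop)] at this
  have hdot : ∀ ω, ξ ω ⬝ᵥ ξ ω = ∑ i, ξ ω i ^ 2 := fun ω => by simp [dotProduct, sq]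
  simp only [hdot]
  have hm := mul_meas_ge_le_integral_of_nonneg (μ := P) (f := fun ω => ∑ i, ξ ω i ^ 2)
    (ae_of_all _ fun ω => Finset.sum_nonneg fun _ _ => sq_nonneg _)
    (integrable_finsetSum _ fun i _ => hi i) (n * σ ^ 2 * l)
  rw [integral_finsetSum _ fun i _ => hi i] at hm
  have hsum : ∑ i, ∫ ω, ξ ω i ^ 2 ∂P ≤ n * σ ^ 2 := by
    simpa using Finset.sum_le_sum fun i (_ : i ∈ Finset.univ) => he i
  have hn' : (0 : ℝ) < n := by exact_mod_cast hn
  refine le_trans (measureReal_mono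
    (Set.ofPred_subset_ofPred.2 fun ω hω => hω.le) (measure_ne_top _ _)) ?_
  rw [le_div_iff₀ hl]
  have hpos : 0 < n * σ ^ 2 := by positivity
  have := hm.trans hsum
  refine le_of_mul_le_mul_left ?_ hpos
  calc _ = n * σ ^ 2 * l * P.real {ω | n * σ ^ 2 * l ≤ ∑ i, ξ ω i ^ 2} := by ring
    _ ≤ _ := by linarith

/-! ### Empirical covariance of the design -/

/-- Concentration of one entry of the empirical covariance of the design. -/
lemma measureReal_gram_entry_le {Ω : Type*} [MeasurableSpace Ω] {P : Measure Ω} {n p : ℕ}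
    (hn : 0 < n) {𝒟 : Measure ℝ} {b : ℝ} (h𝒟 : IsDesignLaw 𝒟 b)
    {X : Ω → Matrix (Fin n) (Fin p) ℝ} (hX : ∀ i j, HasLaw (fun ω => X ω i j) 𝒟 P)
    (h : iIndepFun (fun (q : Fin n × Fin p) ω => X ω q.1 q.2) P) {l : ℝ} (hl : 0 ≤ l)
    (j k : Fin p) :
    P.real {ω | 3 * (b ^ 2 + 1) * √(l / n) <
        |((1 / (n : ℝ)) • ((X ω)ᵀ * X ω) - 1 : Matrix (Fin p) (Fin p) ℝ) j k|} ≤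
      2 * Real.exp (-(4 * l)) := by
  have := h.isProbabilityMeasure
  have := h𝒟.isProbabilityMeasure
  have hn' : (0 : ℝ) < n := by exact_mod_cast hn
  have hm : ∀ i j, AEMeasurable (fun ω => X ω i j) P := fun i j => (hX i j).aemeasurable
  have hb𝒟 : ∀ᵐ x ∂𝒟, |x| ≤ b := by
    have : ∀ᵐ x ∂𝒟, x ∈ Set.Icc (-b) b := by
      rw [ae_iff]; exact h𝒟.support
    filter_upwards [this] with x hx using abs_le.2 hx
  have hbX : ∀ i j, ∀ᵐ ω ∂P, |X ω i j| ≤ b := fun i j => by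
    rw [← (hX i j).map_eq] at hb𝒟
    exact ae_of_ae_map (hm i j) hb𝒟
  have hmean : ∀ i j, ∫ ω, X ω i j ∂P = 0 := fun i j => by
    have := h𝒟.mean
    rwa [← (hX i j).map_eq, integral_map (hm i j) (by fun_prop)] at this
  have hvar : ∀ i j, ∫ ω, X ω i j * X ω i j ∂P = 1 := fun i j => by
    have := h𝒟.variance
    rw [variance_of_integral_eq_zero (by fun_prop) h𝒟.mean, ← (hX i j).map_eq,
      integral_map (hm i j) (by fun_prop)] at this
    simpa [sq] using this
  set δ : ℝ := (1 : Matrix (Fin p) (Fin p) ℝ) j k with hδ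
  have hδ01 : 0 ≤ δ ∧ δ ≤ 1 := by
    rw [hδ, Matrix.one_apply]; split_ifs <;> simp
  let W : Fin n → Ω → ℝ := fun i ω => X ω i j * X ω i k - δ
  have hWbd : ∀ i, ∀ᵐ ω ∂P, W i ω ∈ Set.Icc (-(b ^ 2 + 1)) (b ^ 2 + 1) := fun i => by
    filter_upwards [hbX i j, hbX i k] with ω h1 h2
    have : |X ω i j * X ω i k| ≤ b ^ 2 := by
      rw [abs_mul, sq]
      exact mul_le_mul h1 h2 (abs_nonneg _) ((abs_nonneg _).trans h1)
    rw [abs_le] at this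
    constructor <;> simp only [W] <;> linarith
  have hWmean : ∀ i, ∫ ω, W i ω ∂P = 0 := fun i => by
    have hprod : Integrable (fun ω => X ω i j * X ω i k) P :=
      Integrable.of_bound (by fun_prop) (b * b) (by
        filter_upwards [hbX i j, hbX i k] with ω h1 h2
        rw [norm_mul]
        exact mul_le_mul h1 h2 (abs_nonneg _) ((abs_nonneg _).trans h1))
    simp only [W]
    rw [integral_sub hprod (integrable_const _), integral_const]
    simp only [probReal_univ, one_smul]
    rcases eq_or_ne j k with rfl | hjk
    · rw [hvar i j, hδ]; simp
    · have hi : IndepFun (fun ω => X ω i j) (fun ω => X ω i k) P :=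
        h.indepFun (i := (i, j)) (j := (i, k)) (by simpa using hjk)
      have := hi.integral_fun_mul_eq_mul_integral (hm i j).aestronglyMeasurable
        (hm i k).aestronglyMeasurable
      rw [this, hmean, hδ, Matrix.one_apply_ne hjk]; simp
  have hWsub : ∀ i, HasSubgaussianMGF (W i) ((b ^ 2 + 1) ^ 2).toNNReal P := fun i => by
    have := hasSubgaussianMGF_of_mem_Icc_of_integral_eq_zero (X := W i)
      (by fun_prop) (hWbd i) (hWmean i)
    convert this using 1
    ext
    have : 0 < b ^ 2 + 1 := by positivity
    rw [Real.coe_toNNReal _ (by positivity)]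
    push_cast
    rw [Real.norm_eq_abs, sub_neg_eq_add, abs_of_pos (by linarith)]
    ring
  have hWi : iIndepFun W P :=
    (iIndepFun_rows (f := fun i j ω => X ω i j) hm h).comp
      (fun _ z => z j * z k - δ) fun _ => by fun_prop
  -- Hoeffding's exponent is 9l/2 for the constant 3; it is rounded down to 4l, enough for a union
  -- bound over p² entries when l = log p.
  have key := measureReal_abs_sum_ge_le hWi hWsub
    (ε := n * (3 * (b ^ 2 + 1) * √(l / n))) (by positivity)
  refine le_trans (measureReal_mono ?_ (measure_ne_top _ _)) (key.trans ?_)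
  · intro ω hω
    rw [Set.mem_ofPred_eq] at hω ⊢
    have e : ((1 / (n : ℝ)) • ((X ω)ᵀ * X ω) - 1 : Matrix (Fin p) (Fin p) ℝ) j k = (∑ i, W i ω) / n := by
      simp only [Matrix.sub_apply, Matrix.smul_apply, Matrix.mul_apply, Matrix.transpose_apply,
        smul_eq_mul, W, Finset.sum_sub_distrib]
      simp
      field_simp
      rfl
    rw [e, abs_div, abs_of_pos hn', lt_div_iff₀ hn'] at hω
    linarith
  · have : 0 < b ^ 2 + 1 := by positivity
    gcongr
    simp only [Finset.sum_const, Finset.card_univ, Fintype.card_fin, nsmul_eq_mul]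
    rw [Real.coe_toNNReal _ (by positivity), mul_pow, mul_pow, Real.sq_sqrt (by positivity)]
    rw [neg_div, neg_le_neg_iff, le_div_iff₀ (by positivity)]
    field_simp
    nlinarith

/-! ### Algebra of the stacked model -/

/-- The matrix `Z = [X; w I; 0]`, so that `X* = R Z`. -/
def stackedDesign {n p : ℕ} (X : Matrix (Fin n) (Fin p) ℝ) (w : ℝ) :
    Matrix (Cols n p) (Fin p) ℝ :=
  Matrix.fromRows X (Matrix.fromRows (w • (1 : Matrix (Fin p) (Fin p) ℝ)) 0)

/-- The vector `[ξ; -w θ₀; w]`, whose projection is the noise of the private regression. -/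
def stackedNoise {n p : ℕ} (ξ : Fin n → ℝ) (w : ℝ) (θ₀ : Fin p → ℝ) : Cols n p → ℝ :=
  Sum.elim ξ (Sum.elim (-(w • θ₀)) (fun _ => w))

section Algebra

variable {n p r : ℕ} (R : Matrix (Fin r) (Cols n p) ℝ) (X : Matrix (Fin n) (Fin p) ℝ)
  (ξ : Fin n → ℝ) (w : ℝ) (θ₀ θhat : Fin p → ℝ)

lemma stackedDesign_mulVec (v : Fin p → ℝ) :
    stackedDesign X w *ᵥ v = Sum.elim (X *ᵥ v) (Sum.elim (w • v) 0) := by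
  rw [stackedDesign, Matrix.fromRows_mulVec, Matrix.fromRows_mulVec, Matrix.smul_mulVec,
    Matrix.one_mulVec, Matrix.zero_mulVec]

lemma privX_eq (y : Fin n → ℝ) : privX R X y w = R * stackedDesign X w := by
  ext a j
  simp only [privX, release, Matrix.toCols₁_apply, Matrix.mul_apply, stackedDesign]
  refine Finset.sum_congr rfl fun c _ => ?_
  rcases c with i | k | z <;> simp [Matrix.one_apply]

/-- The signal Xθ₀ cancels, but the block wI has no counterpart in the response and leaves -wθ₀. -/
lemma privY_sub :
    privY R X (response X θ₀ ξ) w - privX R X (response X θ₀ ξ) w *ᵥ θ₀ =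
      R *ᵥ stackedNoise ξ w θ₀ := by
  have h : privY R X (response X θ₀ ξ) w =
      R *ᵥ Sum.elim (response X θ₀ ξ) (Sum.elim 0 (fun _ => w)) := by
    ext a
    simp only [privY, release, Matrix.toCols₂_apply, Matrix.mul_apply, Matrix.mulVec, dotProduct]
    refine Finset.sum_congr rfl fun c _ => ?_
    rcases c with i | k | z
    · simp
    · simp
    · simp [Subsingleton.elim z 0]
  rw [h, privX_eq, ← Matrix.mulVec_mulVec, ← Matrix.mulVec_sub, stackedDesign_mulVec]
  congr 1
  ext c
  rcases c with i | k | z <;> simp [stackedNoise, response]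

/-- The vector hit by RᵀR - I is Z(θ₀ - θhat) + [0; -wθ₀; w]. Expanding the first summand over
columns of Z leaves θhat only as a coefficient vector, so near-preservation is needed only for
vectors not involving θhat. -/
lemma bias_apply (j : Fin p) :
    bias R X w θ₀ θhat j =
      ∑ k, ((1 / (n : ℝ)) • (Xᵀ * X) - 1 : Matrix (Fin p) (Fin p) ℝ) j k * (θ₀ - θhat) k +
      1 / (n : ℝ) *
        (∑ k, ((R *ᵥ (stackedDesign X w)ᵀ j) ⬝ᵥ (R *ᵥ (stackedDesign X w)ᵀ k) -
            (stackedDesign X w)ᵀ j ⬝ᵥ (stackedDesign X w)ᵀ k) * (θ₀ - θhat) k +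
          ((R *ᵥ (stackedDesign X w)ᵀ j) ⬝ᵥ (R *ᵥ stackedNoise 0 w θ₀) -
            (stackedDesign X w)ᵀ j ⬝ᵥ stackedNoise 0 w θ₀)) := by
  set Z := stackedDesign X w with hZ
  have hT : Matrix.fromCols Xᵀ (Matrix.fromCols (w • (1 : Matrix (Fin p) (Fin p) ℝ))
      (0 : Matrix (Fin p) (Fin 1) ℝ)) = Zᵀ := by
    ext i c
    rcases c with i | k | z <;> simp [hZ, stackedDesign, Matrix.one_apply, eq_comm]
  have hv : Sum.elim (X *ᵥ (θ₀ - θhat)) (Sum.elim (-(w • θhat)) (fun _ => w)) =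
      Z *ᵥ (θ₀ - θhat) + stackedNoise 0 w θ₀ := by
    rw [hZ, stackedDesign_mulVec]
    ext c
    rcases c with i | k | z
    · simp [stackedNoise]
    · simp [stackedNoise]; ring
    · simp [stackedNoise]
  have hbil : ∀ x : Cols n p → ℝ, ((Zᵀ * (Rᵀ * R - 1)) *ᵥ x) j =
      (R *ᵥ Zᵀ j) ⬝ᵥ (R *ᵥ x) - Zᵀ j ⬝ᵥ x := by
    intro x
    rw [← Matrix.mulVec_mulVec, Matrix.sub_mulVec, Matrix.one_mulVec, Matrix.mulVec_sub,
      ← Matrix.mulVec_mulVec, Pi.sub_apply]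
    congr 1
    change Zᵀ j ⬝ᵥ (Rᵀ *ᵥ (R *ᵥ x)) = _
    rw [Matrix.dotProduct_mulVec, Matrix.vecMul_transpose]
  have hZv : ∀ y : Cols n p → ℝ, y ⬝ᵥ (Z *ᵥ (θ₀ - θhat)) = ∑ k, (y ⬝ᵥ Zᵀ k) * (θ₀ - θhat) k := by
    intro y
    rw [Matrix.dotProduct_mulVec]
    rfl
  have hRZv : (R *ᵥ Zᵀ j) ⬝ᵥ (R *ᵥ (Z *ᵥ (θ₀ - θhat))) =
      ∑ k, ((R *ᵥ Zᵀ j) ⬝ᵥ (R *ᵥ Zᵀ k)) * (θ₀ - θhat) k := by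
    rw [Matrix.dotProduct_mulVec, hZv]
    refine Finset.sum_congr rfl fun k _ => ?_
    rw [Matrix.dotProduct_mulVec]
  rw [bias, hT, hv, Pi.add_apply, Pi.smul_apply, smul_eq_mul, hbil, Matrix.mulVec_add,
    dotProduct_add, dotProduct_add, hZv, hRZv]
  congr 1
  congr 1
  simp only [sub_mul, Finset.sum_sub_distrib]
  ring

lemma stackedDesign_dot (j k : Fin p) :
    (stackedDesign X w)ᵀ j ⬝ᵥ (stackedDesign X w)ᵀ k =
      (Xᵀ * X) j k + w ^ 2 * (1 : Matrix (Fin p) (Fin p) ℝ) j k := by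
  simp only [dotProduct, Fintype.sum_sum_type, Matrix.mul_apply, Matrix.transpose_apply,
    stackedDesign]
  simp [Matrix.one_apply, sq]
  split_ifs <;> simp_all [eq_comm]

/-- Divided by n, the last term is the drift -tθ₀ of the private regression. -/
lemma stackedDesign_dot_noise (j : Fin p) :
    (stackedDesign X w)ᵀ j ⬝ᵥ stackedNoise ξ w θ₀ = Xᵀ j ⬝ᵥ ξ - w ^ 2 * θ₀ j := by
  simp only [dotProduct, Fintype.sum_sum_type, Matrix.transpose_apply, stackedDesign, stackedNoise]
  simp [Matrix.one_apply]
  ring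

lemma stackedNoise_dot (h : θ₀ ⬝ᵥ θ₀ = 1) :
    stackedNoise ξ w θ₀ ⬝ᵥ stackedNoise ξ w θ₀ = ξ ⬝ᵥ ξ + 2 * w ^ 2 := by
  simp only [dotProduct] at h
  simp only [dotProduct, Fintype.sum_sum_type, stackedNoise]
  simp only [Sum.elim_inl, Sum.elim_inr, Pi.neg_apply, Pi.smul_apply, smul_eq_mul]
  have : ∀ i, -(w * θ₀ i) * -(w * θ₀ i) = w ^ 2 * (θ₀ i * θ₀ i) := fun i => by ring
  simp only [this, ← Finset.mul_sum, h]
  simp; ring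

end Algebra

/-! ### Deterministic ℓ₁ bound for a Lasso with drift -/

section Lasso

variable {n p r : ℕ}

lemma norm_toLp_two_sq {ι : Type*} [Fintype ι] (x : ι → ℝ) : ‖WithLp.toLp 2 x‖ ^ 2 = x ⬝ᵥ x := by
  rw [EuclideanSpace.real_norm_sq_eq]; simp [dotProduct, sq]

/-- The basic inequality of the Lasso. -/
lemma lasso_basic_inequality {A : Matrix (Fin r) (Fin p) ℝ} {z : Fin r → ℝ} {lam : ℝ}
    (hn : 0 < n) {θ₀ θhat : Fin p → ℝ} (h : lassoObj n A z lam θhat ≤ lassoObj n A z lam θ₀) :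
    1 / 2 * (1 / (n : ℝ) * ((A *ᵥ (θhat - θ₀)) ⬝ᵥ (A *ᵥ (θhat - θ₀)))) + lam * ∑ j, |θhat j| ≤
      1 / (n : ℝ) * ((A *ᵥ (θhat - θ₀)) ⬝ᵥ (z - A *ᵥ θ₀)) + lam * ∑ j, |θ₀ j| := by
  have hn' : (0 : ℝ) < n := by exact_mod_cast hn
  simp only [lassoObj, norm_toLp_two_sq, PiLp.norm_eq_of_L1, Real.norm_eq_abs] at h
  have e1 : A *ᵥ θhat - z = A *ᵥ (θhat - θ₀) - (z - A *ᵥ θ₀) := by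
    rw [Matrix.mulVec_sub]; abel
  have e2 : A *ᵥ θ₀ - z = -(z - A *ᵥ θ₀) := by abel
  rw [e1, e2] at h
  generalize A *ᵥ (θhat - θ₀) = d at *
  generalize z - A *ᵥ θ₀ = e at *
  have hde : e ⬝ᵥ d = d ⬝ᵥ e := dotProduct_comm _ _
  simp only [sub_dotProduct, dotProduct_sub, neg_dotProduct, dotProduct_neg, neg_neg, hde] at h
  have : 1 / (2 * (n : ℝ)) = 1 / 2 * (1 / n) := by field_simp
  rw [this] at h
  linarith

lemma abs_bilin_le {M : Matrix (Fin p) (Fin p) ℝ} {D : ℝ} (hM : ∀ j k, |M j k| ≤ D)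
    (u : Fin p → ℝ) : |u ⬝ᵥ (M *ᵥ u)| ≤ D * (∑ j, |u j|) ^ 2 := by
  simp only [dotProduct, Matrix.mulVec, Finset.mul_sum]
  calc |∑ j, ∑ k, u j * (M j k * u k)| ≤ ∑ j, ∑ k, |u j * (M j k * u k)| :=
        (Finset.abs_sum_le_sum_abs _ _).trans
          (Finset.sum_le_sum fun j _ => Finset.abs_sum_le_sum_abs _ _)
    _ ≤ ∑ j, ∑ k, D * (|u j| * |u k|) := by
        refine Finset.sum_le_sum fun j _ => Finset.sum_le_sum fun k _ => ?_
        rw [abs_mul, abs_mul]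
        have := mul_le_mul_of_nonneg_right (hM j k) (mul_nonneg (abs_nonneg (u j)) (abs_nonneg (u k)))
        linarith
    _ = D * (∑ j, |u j|) ^ 2 := by
        rw [sq, Finset.sum_mul_sum, Finset.mul_sum]
        simp only [Finset.mul_sum]

/-- The triangle inequality for `ℓ₁` norms, split along the support of `θ₀`. -/
lemma l1_sub_le_support (θ₀ θ : Fin p → ℝ) :
    ∑ j, |θ₀ j| - ∑ j, |θ j| ≤
      2 * (√(sparsity θ₀ : ℝ) * √((θ - θ₀) ⬝ᵥ (θ - θ₀))) - ∑ j, |(θ - θ₀) j| := by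
  classical
  set S : Finset (Fin p) := Finset.univ.filter fun j => θ₀ j ≠ 0 with hS
  have hcard : (sparsity θ₀ : ℝ) = S.card := by
    rw [sparsity, Set.ncard_eq_toFinset_card']
    congr 2
    ext j; simp [hS]
  have h1 : ∑ j ∈ S, |(θ - θ₀) j| ≤ √(sparsity θ₀ : ℝ) * √((θ - θ₀) ⬝ᵥ (θ - θ₀)) := by
    rw [← Real.sqrt_mul (Nat.cast_nonneg _)]
    apply Real.le_sqrt_of_sq_le
    refine sq_sum_le_card_mul_sum_sq.trans ?_
    rw [hcard]
    gcongr
    simp only [sq_abs, dotProduct, ← sq]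
    exact Finset.sum_le_sum_of_subset_of_nonneg (Finset.subset_univ _) fun _ _ _ => sq_nonneg _
  have h2 : ∑ j, (|θ₀ j| - |θ j| + |(θ - θ₀) j|) ≤ ∑ j ∈ S, 2 * |(θ - θ₀) j| := by
    rw [hS, Finset.sum_filter]
    refine Finset.sum_le_sum fun j _ => ?_
    split_ifs with hj
    · have := abs_sub_abs_le_abs_sub (θ₀ j) (θ j)
      rw [abs_sub_comm] at this
      simp only [Pi.sub_apply]; linarith
    · rw [not_not] at hj
      simp [hj]
  rw [Finset.sum_add_distrib, Finset.sum_sub_distrib, ← Finset.mul_sum] at h2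
  linarith

/-- The `ℓ₁` error bound of a Lasso whose noise is `-t θ₀` up to `lam / 2` and whose Gram matrix
is `φ I` up to `D`. -/
lemma lasso_l1_error_le {A : Matrix (Fin r) (Fin p) ℝ} {z : Fin r → ℝ} {lam t φ D κ : ℝ}
    (hn : 0 < n) {θ₀ θhat : Fin p → ℝ} (hθ₀ : θ₀ ⬝ᵥ θ₀ = 1)
    (h : lassoObj n A z lam θhat ≤ lassoObj n A z lam θ₀)
    (hlam : 0 < lam) (ht : 0 ≤ t) (hφ : 0 < φ) (hκ : κ = 2 * lam * √(sparsity θ₀ : ℝ) + t)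
    (hG : ∀ j k, |((1 / (n : ℝ)) • (Aᵀ * A) - φ • 1 : Matrix (Fin p) (Fin p) ℝ) j k| ≤ D)
    (hN : ∀ j, |1 / (n : ℝ) * (Aᵀ *ᵥ (z - A *ᵥ θ₀)) j + t * θ₀ j| ≤ lam / 2)
    (hD0 : 0 ≤ D) (hD : 8 * D * κ ^ 2 ≤ lam ^ 2 * φ) :
    ∑ j, |(θhat - θ₀) j| ≤ 2 * κ ^ 2 / (lam * φ) := by
  have hn' : (0 : ℝ) < n := by exact_mod_cast hn
  have hb := lasso_basic_inequality hn h
  have hs := l1_sub_le_support θ₀ θhat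
  set u := θhat - θ₀ with hu
  set ℓ := ∑ j, |u j| with hℓ
  set m := √(u ⬝ᵥ u) with hm
  have huu : 0 ≤ u ⬝ᵥ u := Finset.sum_nonneg fun _ _ => mul_self_nonneg _
  have hm0 : 0 ≤ m := Real.sqrt_nonneg _
  have hmm : m ^ 2 = u ⬝ᵥ u := Real.sq_sqrt huu
  have hℓ0 : 0 ≤ ℓ := Finset.sum_nonneg fun _ _ => abs_nonneg _
  set Q := 1 / (n : ℝ) * ((A *ᵥ u) ⬝ᵥ (A *ᵥ u)) with hQ
  have hQ0 : 0 ≤ Q := by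
    have : 0 ≤ (A *ᵥ u) ⬝ᵥ (A *ᵥ u) := Finset.sum_nonneg fun _ _ => mul_self_nonneg _
    positivity
  have hQlow : φ * m ^ 2 - D * ℓ ^ 2 ≤ Q := by
    have := abs_bilin_le hG u
    have e : u ⬝ᵥ (((1 / (n : ℝ)) • (Aᵀ * A) - φ • 1 : Matrix (Fin p) (Fin p) ℝ) *ᵥ u) =
        Q - φ * m ^ 2 := by
      rw [Matrix.sub_mulVec, Matrix.smul_mulVec, Matrix.smul_mulVec, Matrix.one_mulVec,
        dotProduct_sub, dotProduct_smul, dotProduct_smul, ← Matrix.mulVec_mulVec,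
        Matrix.dotProduct_mulVec, Matrix.vecMul_transpose, hmm, hQ]
      simp
    rw [e, abs_le] at this
    linarith [this.1]
  have hnoise : 1 / (n : ℝ) * ((A *ᵥ u) ⬝ᵥ (z - A *ᵥ θ₀)) ≤ lam / 2 * ℓ + t * m := by
    set g := Aᵀ *ᵥ (z - A *ᵥ θ₀) with hg
    have e : (A *ᵥ u) ⬝ᵥ (z - A *ᵥ θ₀) = ∑ j, u j * g j := by
      rw [← Matrix.vecMul_transpose, ← Matrix.dotProduct_mulVec]; rfl
    have hcs : -(∑ j, u j * θ₀ j) ≤ m := by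
      have h1 : (∑ j, u j * θ₀ j) ^ 2 ≤ m ^ 2 := by
        rw [hmm]
        refine (Finset.sum_mul_sq_le_sq_mul_sq _ _ _).trans (le_of_eq ?_)
        simp only [dotProduct, ← sq] at hθ₀ ⊢
        rw [hθ₀, mul_one]
      linarith [(abs_le_of_sq_le_sq' h1 hm0).1]
    have e2 : 1 / (n : ℝ) * ∑ j, u j * g j =
        ∑ j, u j * (1 / (n : ℝ) * g j + t * θ₀ j) + t * -(∑ j, u j * θ₀ j) := by
      rw [Finset.mul_sum, mul_neg, Finset.mul_sum, ← sub_eq_add_neg, ← Finset.sum_sub_distrib]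
      refine Finset.sum_congr rfl fun j _ => by ring
    have h3 : ∑ j, u j * (1 / (n : ℝ) * g j + t * θ₀ j) ≤ lam / 2 * ℓ := by
      rw [hℓ, Finset.mul_sum]
      refine Finset.sum_le_sum fun j _ => (le_abs_self _).trans ?_
      rw [abs_mul, mul_comm]
      exact mul_le_mul_of_nonneg_right (hN j) (abs_nonneg _)
    rw [e, e2]
    linarith [mul_le_mul_of_nonneg_left hcs ht]
  -- The noise consumes half of the ℓ₁ penalty; the other half survives on the left, so no separate
  -- cone condition is needed.
  have main : 1 / 2 * Q + lam / 2 * ℓ ≤ κ * m := by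
    have := mul_le_mul_of_nonneg_left hs hlam.le
    rw [hκ]
    nlinarith
  have hκ0 : 0 ≤ κ := by rw [hκ]; positivity
  have hℓm : lam * ℓ ≤ 2 * (κ * m) := by linarith
  -- Since Q ≥ 0, λℓ ≤ 2κm already holds. Feeding this back through `hD` absorbs the Gram error into
  -- half of the curvature.
  have hDℓ : D * ℓ ^ 2 ≤ φ * m ^ 2 / 2 := by
    have h1 : lam ^ 2 * ℓ ^ 2 ≤ 4 * (κ ^ 2 * m ^ 2) := by
      have := pow_le_pow_left₀ (by positivity) hℓm 2
      nlinarith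
    have h2 := mul_le_mul_of_nonneg_left h1 hD0
    have h3 := mul_le_mul_of_nonneg_right hD (sq_nonneg m)
    have h4 : lam ^ 2 * (D * ℓ ^ 2) ≤ lam ^ 2 * (φ * m ^ 2 / 2) := by nlinarith
    exact le_of_mul_le_mul_left h4 (by positivity)
  rw [le_div_iff₀ (by positivity)]
  have h5 : φ * m ^ 2 / 4 + lam / 2 * ℓ ≤ κ * m := by linarith
  -- Maximizing over m: κm - φm²/4 ≤ κ²/φ.
  nlinarith [sq_nonneg (φ * m - 2 * κ), mul_le_mul_of_nonneg_left h5 hφ.le]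

end Lasso

/-! ### Regular data: consequences and probability -/

/-- The projection `R` distorts the inner product of `u` and `v` by a relative error at most `s`. -/
def NearlyPreserves {r : ℕ} {κ : Type*} [Fintype κ] (R : Matrix (Fin r) κ ℝ) (s : ℝ)
    (u v : κ → ℝ) : Prop :=
  |(R *ᵥ u) ⬝ᵥ (R *ᵥ v) - u ⬝ᵥ v| ≤ s * (√(u ⬝ᵥ u) * √(v ⬝ᵥ v))

/-- The data on which the error analysis of the private Lasso is carried out. -/
structure IsRegular {n p r : ℕ} (R : Matrix (Fin r) (Cols n p) ℝ) (X : Matrix (Fin n) (Fin p) ℝ)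
    (ξ : Fin n → ℝ) (w σ : ℝ) (θ₀ : Fin p → ℝ) (l a s : ℝ) : Prop where
  gram : ∀ j k, |((1 / (n : ℝ)) • (Xᵀ * X) - 1 : Matrix (Fin p) (Fin p) ℝ) j k| ≤ a
  cross : ∀ j, |Xᵀ j ⬝ᵥ ξ| ≤ 2 * σ * √l * √(Xᵀ j ⬝ᵥ Xᵀ j)
  noise : ξ ⬝ᵥ ξ ≤ n * σ ^ 2 * l
  proj : ∀ j k, NearlyPreserves R s ((stackedDesign X w)ᵀ j) ((stackedDesign X w)ᵀ k)
  proj_noise : ∀ j, NearlyPreserves R s ((stackedDesign X w)ᵀ j) (stackedNoise ξ w θ₀)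
  proj_shift : ∀ j, NearlyPreserves R s ((stackedDesign X w)ᵀ j) (stackedNoise 0 w θ₀)

/-- On regular data, the bias of the debiased private Lasso is small. -/
lemma IsRegular.norm_bias_le {n p r : ℕ} {R : Matrix (Fin r) (Cols n p) ℝ}
    {X : Matrix (Fin n) (Fin p) ℝ} {ξ : Fin n → ℝ} {w σ l a s K lam : ℝ} {θ₀ θhat : Fin p → ℝ}
    (h : IsRegular R X ξ w σ θ₀ l a s) (hn : 0 < n) (hθ₀ : θ₀ ⬝ᵥ θ₀ = 1)
    (hmin : IsPrivateLasso R X (response X θ₀ ξ) w lam θhat)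
    (hσ : 0 < σ) (hl : 0 ≤ l) (ha0 : 0 ≤ a) (ha1 : a ≤ 1) (hs : 0 ≤ s) (hlam : 0 < lam)
    (hK : w ^ 2 / n ≤ K)
    (hD : 8 * (a + s * (2 + K)) * kappa n (sparsity θ₀) lam w ^ 2 ≤ lam ^ 2 * phi n w)
    (hN : s * √(2 + K) * √(σ ^ 2 * l + 2 * K) + 3 * σ * √(l / n) ≤ lam / 2) :
    ‖bias R X w θ₀ θhat‖ ≤
      (a + s * (2 + K)) * (2 * kappa n (sparsity θ₀) lam w ^ 2 / (lam * phi n w)) +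
        s * √(2 + K) * √(2 * (w ^ 2 / n)) := by
  have hn' : (0 : ℝ) < n := by exact_mod_cast hn
  set Z := stackedDesign X w with hZ
  set t := w ^ 2 / n with ht
  have ht0 : 0 ≤ t := by positivity
  have hwt : w ^ 2 = n * t := by rw [ht]; field_simp
  have hK0 : 0 ≤ K := ht0.trans hK
  have hφ : 0 < phi n w := by rw [phi]; positivity
  have hXX : ∀ j, Xᵀ j ⬝ᵥ Xᵀ j ≤ n * 2 := fun j => by
    have h1 := (abs_le.1 (h.gram j j)).2
    simp only [Matrix.sub_apply, Matrix.smul_apply, Matrix.one_apply_eq, smul_eq_mul] at h1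
    have h2 : 1 / (n : ℝ) * (Xᵀ * X) j j ≤ 2 := by linarith
    rw [div_mul_eq_mul_div, one_mul, div_le_iff₀ hn'] at h2
    have e : (Xᵀ * X) j j = Xᵀ j ⬝ᵥ Xᵀ j := rfl
    rw [← e]; linarith
  have hZZ : ∀ j, √(Zᵀ j ⬝ᵥ Zᵀ j) ≤ √n * √(2 + K) := fun j => by
    rw [← Real.sqrt_mul hn'.le]
    apply Real.sqrt_le_sqrt
    rw [hZ, stackedDesign_dot, Matrix.one_apply_eq, hwt]
    have := hXX j
    have e : (Xᵀ * X) j j = Xᵀ j ⬝ᵥ Xᵀ j := rfl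
    rw [e]
    nlinarith [mul_le_mul_of_nonneg_left hK hn'.le]
  have hnn : √(n : ℝ) * √(n : ℝ) = n := Real.mul_self_sqrt hn'.le
  have hproj : ∀ j k, |1 / (n : ℝ) * ((R *ᵥ Zᵀ j) ⬝ᵥ (R *ᵥ Zᵀ k) - Zᵀ j ⬝ᵥ Zᵀ k)| ≤
      s * (2 + K) := fun j k => by
    have h1 : |(R *ᵥ Zᵀ j) ⬝ᵥ (R *ᵥ Zᵀ k) - Zᵀ j ⬝ᵥ Zᵀ k| ≤ n * (s * (2 + K)) := by
      refine (h.proj j k).trans ?_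
      calc s * (√(Zᵀ j ⬝ᵥ Zᵀ j) * √(Zᵀ k ⬝ᵥ Zᵀ k))
          ≤ s * ((√n * √(2 + K)) * (√n * √(2 + K))) := by
            gcongr
            · exact hZZ j
            · exact hZZ k
        _ = (√n * √n) * (s * (√(2 + K) * √(2 + K))) := by ring
        _ = n * (s * (2 + K)) := by rw [hnn, Real.mul_self_sqrt (by linarith)]
    rw [abs_mul, abs_of_pos (by positivity : (0 : ℝ) < 1 / n), div_mul_eq_mul_div, one_mul,
      div_le_iff₀ hn']
    linarith
  -- Used with ζ = ξ for the Lasso noise and with ζ = 0 for the shift in the bias.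
  have hprojN : ∀ (ζ : Fin n → ℝ) (C : ℝ), ζ ⬝ᵥ ζ + 2 * w ^ 2 ≤ n * C → ∀ j,
      NearlyPreserves R s (Zᵀ j) (stackedNoise ζ w θ₀) →
      |1 / (n : ℝ) * ((R *ᵥ Zᵀ j) ⬝ᵥ (R *ᵥ stackedNoise ζ w θ₀) - Zᵀ j ⬝ᵥ stackedNoise ζ w θ₀)| ≤
      s * √(2 + K) * √C := fun ζ C hC j hj => by
    have h1 : |(R *ᵥ Zᵀ j) ⬝ᵥ (R *ᵥ stackedNoise ζ w θ₀) - Zᵀ j ⬝ᵥ stackedNoise ζ w θ₀| ≤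
        n * (s * √(2 + K) * √C) := by
      refine hj.trans ?_
      have h2 : √(stackedNoise ζ w θ₀ ⬝ᵥ stackedNoise ζ w θ₀) ≤ √n * √C := by
        rw [← Real.sqrt_mul hn'.le, stackedNoise_dot ζ w θ₀ hθ₀]
        exact Real.sqrt_le_sqrt hC
      calc s * (√(Zᵀ j ⬝ᵥ Zᵀ j) * √(stackedNoise ζ w θ₀ ⬝ᵥ stackedNoise ζ w θ₀))
          ≤ s * ((√n * √(2 + K)) * (√n * √C)) := by
            gcongr
            exact hZZ j
        _ = (√n * √n) * (s * √(2 + K) * √C) := by ring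
        _ = n * (s * √(2 + K) * √C) := by rw [hnn]
    rw [abs_mul, abs_of_pos (by positivity : (0 : ℝ) < 1 / n), div_mul_eq_mul_div, one_mul,
      div_le_iff₀ hn']
    linarith
  set A := privX R X (response X θ₀ ξ) w with hA
  have hAZ : A = R * Z := privX_eq R X w _
  have hAj : ∀ j, Aᵀ j = R *ᵥ Zᵀ j := fun j => by
    rw [hAZ]; ext a
    simp [Matrix.mul_apply, Matrix.mulVec, dotProduct]
  have hG : ∀ j k, |((1 / (n : ℝ)) • (Aᵀ * A) - phi n w • 1 : Matrix (Fin p) (Fin p) ℝ) j k| ≤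
      a + s * (2 + K) := fun j k => by
    have e : ((1 / (n : ℝ)) • (Aᵀ * A) - phi n w • 1 : Matrix (Fin p) (Fin p) ℝ) j k =
        ((1 / (n : ℝ)) • (Xᵀ * X) - 1 : Matrix (Fin p) (Fin p) ℝ) j k +
        1 / (n : ℝ) * ((R *ᵥ Zᵀ j) ⬝ᵥ (R *ᵥ Zᵀ k) - Zᵀ j ⬝ᵥ Zᵀ k) := by
      have e1 : (Aᵀ * A) j k = (R *ᵥ Zᵀ j) ⬝ᵥ (R *ᵥ Zᵀ k) := by rw [← hAj, ← hAj]; rfl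
      rw [hZ, stackedDesign_dot, ← hZ]
      simp only [Matrix.sub_apply, Matrix.smul_apply, smul_eq_mul, e1, phi]
      field_simp
      ring
    rw [e]
    exact (abs_add_le _ _).trans (add_le_add (h.gram j k) (hproj j k))
  have hNoise : ∀ j, |1 / (n : ℝ) *
      (Aᵀ *ᵥ (privY R X (response X θ₀ ξ) w - A *ᵥ θ₀)) j + t * θ₀ j| ≤ lam / 2 := fun j => by
    have e : 1 / (n : ℝ) * (Aᵀ *ᵥ (privY R X (response X θ₀ ξ) w - A *ᵥ θ₀)) j + t * θ₀ j =
        1 / (n : ℝ) * ((R *ᵥ Zᵀ j) ⬝ᵥ (R *ᵥ stackedNoise ξ w θ₀) - Zᵀ j ⬝ᵥ stackedNoise ξ w θ₀) +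
        1 / (n : ℝ) * (Xᵀ j ⬝ᵥ ξ) := by
      have e1 : (Aᵀ *ᵥ (R *ᵥ stackedNoise ξ w θ₀)) j =
          (R *ᵥ Zᵀ j) ⬝ᵥ (R *ᵥ stackedNoise ξ w θ₀) := by rw [← hAj]; rfl
      rw [hA, privY_sub, ← hA, e1, hZ, stackedDesign_dot_noise, ← hZ, hwt]
      field_simp
      ring
    have h1 := hprojN ξ (σ ^ 2 * l + 2 * K) (by
      rw [hwt]
      nlinarith [h.noise, mul_le_mul_of_nonneg_left hK hn'.le]) j (h.proj_noise j)
    have h2 : |1 / (n : ℝ) * (Xᵀ j ⬝ᵥ ξ)| ≤ 3 * σ * √(l / n) := by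
      rw [abs_mul, abs_of_pos (by positivity : (0 : ℝ) < 1 / n), div_mul_eq_mul_div, one_mul,
        div_le_iff₀ hn']
      refine (h.cross j).trans ?_
      have h3 : √(Xᵀ j ⬝ᵥ Xᵀ j) ≤ √n * (3 / 2) := by
        refine (Real.sqrt_le_sqrt (hXX j)).trans ?_
        rw [Real.sqrt_mul hn'.le]
        gcongr
        rw [Real.sqrt_le_left (by norm_num)]
        norm_num
      calc 2 * σ * √l * √(Xᵀ j ⬝ᵥ Xᵀ j) ≤ 2 * σ * √l * (√n * (3 / 2)) := by gcongr
        _ = 3 * σ * (√l / √n) * (√n * √n) := by field_simp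
        _ = 3 * σ * √(l / n) * n := by rw [hnn, Real.sqrt_div hl]
    rw [e]
    exact (abs_add_le _ _).trans ((add_le_add h1 h2).trans hN)
  have hell := lasso_l1_error_le (t := t) hn hθ₀ (hmin θ₀) hlam ht0 hφ rfl hG hNoise
    (by positivity) hD
  set κ := kappa n (sparsity θ₀) lam w with hκ
  change ∑ j, |(θhat - θ₀) j| ≤ 2 * κ ^ 2 / (lam * phi n w) at hell
  have hell' : ∑ j, |(θ₀ - θhat) j| ≤ 2 * κ ^ 2 / (lam * phi n w) := by
    simpa only [Pi.sub_apply, abs_sub_comm] using hell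
  have hbound : 0 ≤ (a + s * (2 + K)) * (2 * κ ^ 2 / (lam * phi n w)) +
      s * √(2 + K) * √(2 * t) := by positivity
  rw [pi_norm_le_iff_of_nonneg hbound]
  intro j
  have h0 := hprojN 0 (2 * t) (by rw [hwt]; simp; linarith) j (h.proj_shift j)
  have hsum : ∀ (f : Fin p → ℝ) (C : ℝ), (∀ k, |f k| ≤ C) →
      |∑ k, f k * (θ₀ - θhat) k| ≤ C * ∑ k, |(θ₀ - θhat) k| := fun f C hf => by
    rw [Finset.mul_sum]
    refine (Finset.abs_sum_le_sum_abs _ _).trans (Finset.sum_le_sum fun k _ => ?_)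
    rw [abs_mul]
    exact mul_le_mul_of_nonneg_right (hf k) (abs_nonneg _)
  have h1 := hsum _ _ (h.gram j)
  have h2 := hsum _ _ (hproj j)
  rw [Real.norm_eq_abs, bias_apply, mul_add, Finset.mul_sum, ← hZ]
  simp only [← mul_assoc] at h2 h0 ⊢
  refine (abs_add_le _ _).trans ((add_le_add h1 ((abs_add_le _ _).trans
    (add_le_add h2 h0))).trans ?_)
  have := mul_le_mul_of_nonneg_left hell' (show 0 ≤ a + s * (2 + K) by positivity)
  linarith

/-- Two subfamilies with disjoint index sets of an independent family are independent. -/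
lemma indepFun_subfamilies {Ω ι α β : Type*} [MeasurableSpace Ω] [Fintype α] [Fintype β]
    {P : Measure Ω} {f : ι → Ω → ℝ} (h : iIndepFun f P) (hf : ∀ i, AEMeasurable (f i) P)
    (g₁ : α → ι) (g₂ : β → ι) (hg : ∀ a b, g₁ a ≠ g₂ b) :
    IndepFun (fun ω a => f (g₁ a) ω) (fun ω b => f (g₂ b) ω) P := by
  classical
  have hd : Disjoint (Finset.univ.image g₁) (Finset.univ.image g₂) := by
    rw [Finset.disjoint_left]
    intro i hi hi'
    simp only [Finset.mem_image, Finset.mem_univ, true_and] at hi hi'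
    obtain ⟨a, rfl⟩ := hi
    obtain ⟨b, hb⟩ := hi'
    exact hg a b hb.symm
  exact (h.indepFun_finset₀ _ _ hd hf).comp
    (φ := fun z a => z ⟨g₁ a, Finset.mem_image_of_mem _ (Finset.mem_univ a)⟩)
    (ψ := fun z b => z ⟨g₂ b, Finset.mem_image_of_mem _ (Finset.mem_univ b)⟩)
    (measurable_pi_lambda _ fun _ => measurable_pi_apply _)
    (measurable_pi_lambda _ fun _ => measurable_pi_apply _)

/-- A Gaussian projection nearly preserves the inner product of vectors independent of it. -/
lemma measureReal_not_nearlyPreserves_le {Ω α κ : Type*} [MeasurableSpace Ω] [MeasurableSpace α]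
    [Fintype κ] {P : Measure Ω} {r : ℕ} (hr : 0 < r) {R : Ω → Matrix (Fin r) κ ℝ}
    (hR : ∀ a c, HasLaw (fun ω => R ω a c) (gaussianReal 0 (r : ℝ≥0)⁻¹) P)
    (h : iIndepFun (fun (q : Fin r × κ) ω => R ω q.1 q.2) P) {U : Ω → α} (hU : AEMeasurable U P)
    (hUR : IndepFun U (fun ω (q : Fin r × κ) => R ω q.1 q.2) P) {u v : α → κ → ℝ}
    (hu : Measurable u) (hv : Measurable v) {s : ℝ} (hs0 : 0 ≤ s) (hs1 : s ≤ 1 / 2) :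
    P.real {ω | ¬ NearlyPreserves (R ω) s (u (U ω)) (v (U ω))} ≤
      4 * Real.exp (-(r * s ^ 2 / 8)) := by
  have := h.isProbabilityMeasure
  have hV : AEMeasurable (fun ω (q : Fin r × κ) => R ω q.1 q.2) P :=
    aemeasurable_pi_lambda _ fun q => (hR q.1 q.2).aemeasurable
  let S : Set (α × (Fin r × κ → ℝ)) :=
    {x | ¬ NearlyPreserves (fun a c => x.2 (a, c)) s (u x.1) (v x.1)}
  have hS : MeasurableSet S := by
    simp only [S, NearlyPreserves, not_le, Matrix.mulVec, dotProduct]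
    apply measurableSet_lt <;> fun_prop
  refine measureReal_prodMk_mem_le hU hV hUR hS fun x => ?_
  refine le_trans (le_of_eq ?_) (measureReal_inner_projection_le hr hR h hs0 hs1 (u x) (v x))
  congr 1
  ext ω
  simp only [S, Set.mem_ofPred_eq, NearlyPreserves, not_le]

/-- The data are regular with high probability. -/
lemma measureReal_not_isRegular_le {Ω : Type*} [MeasurableSpace Ω] {P : Measure Ω}
    [IsProbabilityMeasure P] {n p r : ℕ} (hn : 0 < n) (hr : 0 < r) {𝒟 : Measure ℝ} {b σ τ : ℝ}
    (h𝒟 : IsDesignLaw 𝒟 b) (hσ : 0 < σ) (hτ : 0 < τ) {X : Ω → Matrix (Fin n) (Fin p) ℝ}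
    {ξ : Ω → Fin n → ℝ} {R : Ω → Matrix (Fin r) (Cols n p) ℝ} (h : IsSample P 𝒟 σ τ X ξ R)
    (w : ℝ) (θ₀ : Fin p → ℝ) {l : ℝ} (hl : 0 < l) (hs : √(32 * l / r) ≤ 1 / 2) :
    P.real {ω | ¬ IsRegular (R ω) (X ω) (ξ ω) w σ θ₀ l (3 * (b ^ 2 + 1) * √(l / n))
        √(32 * l / r)} ≤
      p ^ 2 * (2 * Real.exp (-(4 * l))) + p * (2 * Real.exp (-(2 * l))) + 1 / l +
        (p ^ 2 + 2 * p) * (4 * Real.exp (-(4 * l))) := by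
  have hr' : (0 : ℝ) < r := by exact_mod_cast hr
  have hX : iIndepFun (fun (q : Fin n × Fin p) ω => X ω q.1 q.2) P :=
    h.indep.precomp Sum.inl_injective
  have hξ : iIndepFun (fun i ω => ξ ω i) P :=
    h.indep.precomp (Sum.inr_injective.comp Sum.inl_injective)
  have hR : iIndepFun (fun (q : Fin r × Cols n p) ω => R ω q.1 q.2) P :=
    h.indep.precomp (Sum.inr_injective.comp Sum.inr_injective)
  have hm : ∀ e, AEMeasurable (entries X ξ R e) P := by
    rintro (⟨i, j⟩ | i | ⟨a, c⟩)
    · exact (h.law_design i j).aemeasurable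
    · exact (h.law_noise i).aemeasurable
    · exact (h.law_proj a c).aemeasurable
  have hXξ : IndepFun (fun ω (q : Fin n × Fin p) => X ω q.1 q.2) (fun ω i => ξ ω i) P :=
    indepFun_subfamilies h.indep hm Sum.inl (Sum.inr ∘ Sum.inl) (by simp)
  -- U gathers X and ξ: all vectors to be projected are measurable functions of it, and it is
  -- independent of R.
  let U : Ω → (Fin n × Fin p) ⊕ Fin n → ℝ := fun ω e =>
    entries X ξ R (Sum.elim Sum.inl (Sum.inr ∘ Sum.inl) e) ω
  have hU : AEMeasurable U P := aemeasurable_pi_lambda _ fun _ => hm _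
  have hUR : IndepFun U (fun ω (q : Fin r × Cols n p) => R ω q.1 q.2) P :=
    indepFun_subfamilies h.indep hm (Sum.elim Sum.inl (Sum.inr ∘ Sum.inl)) (Sum.inr ∘ Sum.inr)
      (by rintro (_ | _) _ <;> simp)
  -- The factor 32 makes the projection exponent rs²/8 equal to 4l.
  have hexp : -((r : ℝ) * √(32 * l / r) ^ 2 / 8) = -(4 * l) := by
    rw [Real.sq_sqrt (by positivity)]
    field_simp
    ring
  have hz : ∀ j, Measurable fun (x : (Fin n × Fin p) ⊕ Fin n → ℝ) =>
      (stackedDesign (fun i j => x (Sum.inl (i, j))) w)ᵀ j := fun j => by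
    refine measurable_pi_lambda _ ?_
    rintro (i | k | o)
    · exact measurable_pi_apply (Sum.inl (i, j))
    · exact measurable_const
    · exact measurable_const
  have hq : Measurable fun (x : (Fin n × Fin p) ⊕ Fin n → ℝ) =>
      (stackedNoise (fun i => x (Sum.inr i)) w θ₀) := by
    refine measurable_pi_lambda _ ?_
    rintro (i | k | o) <;> simp only [stackedNoise, Sum.elim_inl, Sum.elim_inr] <;> fun_prop
  have hproj : ∀ u v : ((Fin n × Fin p) ⊕ Fin n → ℝ) → Cols n p → ℝ, Measurable u → Measurable v →
      P.real {ω | ¬ NearlyPreserves (R ω) √(32 * l / r) (u (U ω)) (v (U ω))} ≤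
        4 * Real.exp (-(4 * l)) := fun u v hu hv => by
    have := measureReal_not_nearlyPreserves_le hr h.law_proj hR hU hUR hu hv
      (Real.sqrt_nonneg (32 * l / r)) hs
    rwa [hexp] at this
  have hcross : ∀ j, P.real {ω | 2 * σ * √l * √((X ω)ᵀ j ⬝ᵥ (X ω)ᵀ j) < |(X ω)ᵀ j ⬝ᵥ ξ ω|} ≤
      2 * Real.exp (-(2 * l)) := fun j => by
    let S : Set ((Fin n × Fin p → ℝ) × (Fin n → ℝ)) :=
      {x | 2 * σ * √l * √((fun i => x.1 (i, j)) ⬝ᵥ (fun i => x.1 (i, j))) <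
        |(fun i => x.1 (i, j)) ⬝ᵥ x.2|}
    have hS : MeasurableSet S := by
      simp only [S, dotProduct]
      apply measurableSet_lt <;> fun_prop
    exact measureReal_prodMk_mem_le (aemeasurable_pi_lambda _ fun q => hm (Sum.inl q))
      (aemeasurable_pi_lambda _ fun i => hm (Sum.inr (Sum.inl i))) hXξ hS fun x =>
        measureReal_dotProduct_noise_le hσ hτ h.law_noise hξ hl.le _
  have hsub : {ω | ¬ IsRegular (R ω) (X ω) (ξ ω) w σ θ₀ l (3 * (b ^ 2 + 1) * √(l / n))
        √(32 * l / r)} ⊆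
      ((((⋃ q : Fin p × Fin p, {ω | 3 * (b ^ 2 + 1) * √(l / n) <
          |((1 / (n : ℝ)) • ((X ω)ᵀ * X ω) - 1 : Matrix (Fin p) (Fin p) ℝ) q.1 q.2|}) ∪
        ⋃ j, {ω | 2 * σ * √l * √((X ω)ᵀ j ⬝ᵥ (X ω)ᵀ j) < |(X ω)ᵀ j ⬝ᵥ ξ ω|}) ∪
        {ω | n * σ ^ 2 * l < ξ ω ⬝ᵥ ξ ω}) ∪
        ⋃ q : Fin p × Fin p, {ω | ¬ NearlyPreserves (R ω) √(32 * l / r)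
          ((stackedDesign (X ω) w)ᵀ q.1) ((stackedDesign (X ω) w)ᵀ q.2)}) ∪
        ((⋃ j, {ω | ¬ NearlyPreserves (R ω) √(32 * l / r)
          ((stackedDesign (X ω) w)ᵀ j) (stackedNoise (ξ ω) w θ₀)}) ∪
        ⋃ j, {ω | ¬ NearlyPreserves (R ω) √(32 * l / r)
          ((stackedDesign (X ω) w)ᵀ j) (stackedNoise 0 w θ₀)}) := by
    intro ω hω
    by_contra hcon
    simp only [Set.mem_union, Set.mem_iUnion, Set.mem_ofPred_eq, not_or, not_exists, not_not,
      not_lt] at hcon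
    obtain ⟨⟨⟨⟨c1, c2⟩, c3⟩, c4⟩, c5, c6⟩ := hcon
    exact hω ⟨fun j k => c1 (j, k), c2, c3, fun j k => c4 (j, k), c5, c6⟩
  have hunion : ∀ {ι : Type} [Fintype ι] (E : ι → Set Ω) (C : ℝ), (∀ i, P.real (E i) ≤ C) →
      P.real (⋃ i, E i) ≤ Fintype.card ι * C := fun {ι} _ E C hE => by
    refine (measureReal_iUnion_fintype_le _).trans ((Finset.sum_le_sum fun i _ => hE i).trans ?_)
    simp
  have b1 := hunion _ _ fun q : Fin p × Fin p =>
    measureReal_gram_entry_le hn h𝒟 h.law_design hX hl.le q.1 q.2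
  have b2 := hunion _ _ hcross
  have b3 := measureReal_sq_norm_noise_le hn hσ hτ h.law_noise hl
  have b4 := hunion _ _ fun q : Fin p × Fin p => hproj _ _ (hz q.1) (hz q.2)
  have b5 := hunion _ _ fun j : Fin p => hproj _ _ (hz j) hq
  have b6 := hunion _ _ fun j : Fin p =>
    hproj _ (fun _ => stackedNoise 0 w θ₀) (hz j) measurable_const
  simp only [Fintype.card_prod, Fintype.card_fin, Nat.cast_mul] at b1 b2 b4 b5 b6
  refine (measureReal_mono hsub (measure_ne_top _ _)).trans ?_
  refine (measureReal_union_le _ _).trans ((add_le_add ((measureReal_union_le _ _).trans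
    (add_le_add ((measureReal_union_le _ _).trans (add_le_add ((measureReal_union_le _ _).trans
      (add_le_add b1 b2)) b3)) b4)) ((measureReal_union_le _ _).trans (add_le_add b5 b6))).trans ?_)
  apply le_of_eq
  ring

/-! ### From the asymptotic conditions to numerical bounds -/

section Rates

lemma mul_sqrt_le_of_le_mul_sqrt {x c n l : ℝ} (hn : 0 < n) (hl : 0 < l)
    (h : x ≤ c * √(n / l)) : x * √(l / n) ≤ c := by
  have e : √(n / l) * √(l / n) = 1 := by
    rw [← Real.sqrt_mul (by positivity), div_mul_div_comm, mul_comm l n, div_self (by positivity),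
      Real.sqrt_one]
  calc x * √(l / n) ≤ c * √(n / l) * √(l / n) := by gcongr
    _ = c := by rw [mul_assoc, e, mul_one]

/-- The entries 1 and √(r/n) of the minimum, multiplied by √(n/l), give √(n/l) and √(r/l). -/
lemma quadratic_rate_le {x c n r l w : ℝ} (hn : 0 < n) (hr : 0 < r) (hl : 0 < l) (hc : 0 ≤ c)
    (h : ‖x‖ ≤ c * ‖√(n / l) * min 1 (min √(r / n) (√(r * n) / w ^ 2))‖) :
    x * √(l / n) ≤ c ∧ x * √(l / r) ≤ c := by
  have h0 : 0 ≤ min 1 (min √(r / n) (√(r * n) / w ^ 2)) := by positivity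
  rw [Real.norm_of_nonneg (by positivity : 0 ≤ √(n / l) * min 1 (min √(r / n) (√(r * n) / w ^ 2)))]
    at h
  have hx := (Real.le_norm_self x).trans h
  constructor
  · refine mul_sqrt_le_of_le_mul_sqrt hn hl (hx.trans ?_)
    gcongr
    exact mul_le_of_le_one_right (by positivity) (min_le_left _ _)
  · refine mul_sqrt_le_of_le_mul_sqrt hr hl (hx.trans ?_)
    gcongr
    have e : √(r / l) = √(n / l) * √(r / n) := by
      rw [← Real.sqrt_mul (by positivity)]; congr 1; field_simp
    rw [e]
    gcongr
    exact (min_le_right _ _).trans (min_le_left _ _)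

lemma linear_rate_le {x c n r l d : ℝ} (hn : 0 < n) (hr : 0 < r) (hl : 0 < l) (hc : 0 ≤ c)
    (hd : 0 ≤ d) (h : ‖x‖ ≤ c * ‖min √(n / l) (min √(r / l) d)‖) :
    x * √(l / n) ≤ c ∧ x * √(l / r) ≤ c := by
  rw [Real.norm_of_nonneg (by positivity : 0 ≤ min √(n / l) (min √(r / l) d))] at h
  have hx := (Real.le_norm_self x).trans h
  constructor
  · refine mul_sqrt_le_of_le_mul_sqrt hn hl (hx.trans ?_)
    gcongr
    exact min_le_left _ _
  · refine mul_sqrt_le_of_le_mul_sqrt hr hl (hx.trans ?_)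
    gcongr
    exact (min_le_right _ _).trans (min_le_left _ _)

lemma sqrt_mul_log_div_eq {n r l w : ℝ} (hn : 0 < n) (hl : 0 < l) (hw : 0 < w) :
    w * l / √(n * r) * √l = √(w ^ 2 / n) * (l * √(l / r)) := by
  rw [Real.sqrt_mul hn.le, Real.sqrt_div (sq_nonneg w), Real.sqrt_sq hw.le,
    Real.sqrt_div hl.le]
  ring

lemma rho_sq {n r : ℕ} (w : ℝ) :
    rho n r w ^ 2 = ((n : ℝ) + r + 1) / (n * r) + w ^ 2 / (n * r) :=
  Real.sq_sqrt (by positivity)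

lemma rho_pos {n r : ℕ} (hn : 0 < n) (hr : 0 < r) (w : ℝ) : 0 < rho n r w := by
  have : (0 : ℝ) < n := by exact_mod_cast hn
  have : (0 : ℝ) < r := by exact_mod_cast hr
  exact Real.sqrt_pos.2 (by positivity)

lemma lamRate_eq {n p r : ℕ} (hp : 0 ≤ Real.log p) :
    lamRate n p r = max √(Real.log p / n) (Real.log p * √(Real.log p / r)) := by
  rw [lamRate, show Real.log p ^ 3 / r = Real.log p ^ 2 * (Real.log p / r) by ring,
    Real.sqrt_mul (sq_nonneg _), Real.sqrt_sq hp]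

/-- The sparsity and bias conditions keep the privacy noise level `w² / n` bounded. -/
lemma noise_level_le {n p r s : ℕ} {w σ lam C : ℝ} (hn : 0 < n) (hr : 0 < r)
    (hl : 1 ≤ Real.log p) (hs : 1 ≤ √(s : ℝ)) (hw : 0 < w) (hσ : 0 < σ) (hC : 0 ≤ C)
    (hlam : lam = 8 * σ * lamRate n p r)
    (h2 : √(w ^ 2 / n) * (Real.log p * √(Real.log p / r)) ≤
      C * max √(Real.log p / n) (Real.log p * √(Real.log p / r)))
    (h4 : 1 / (σ * rho n r w) * (4 * kappa n s lam w ^ 2 / (lam * phi n w)) *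
      √(Real.log p / n) ≤ 1 / (σ * (1 + C))) :
    w ^ 2 / n ≤ max 1 (C ^ 2) := by
  by_contra hcon
  rw [not_le, max_lt_iff] at hcon
  obtain ⟨ht1, htC⟩ := hcon
  have hn' : (0 : ℝ) < n := by exact_mod_cast hn
  have hr' : (0 : ℝ) < r := by exact_mod_cast hr
  have hr1 : (1 : ℝ) ≤ r := by exact_mod_cast hr
  rw [lamRate_eq (by linarith)] at hlam
  have hρ := rho_pos hn hr w
  have hρ2 := rho_sq (n := n) (r := r) w
  have hκ : kappa n s lam w = 2 * lam * √(s : ℝ) + w ^ 2 / n := rfl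
  have hφ : phi n w = 1 + w ^ 2 / n := rfl
  set κ := kappa n s lam w
  set φ := phi n w
  set ρ := rho n r w
  set l := Real.log p with hldef
  have hl0 : 0 < l := by linarith
  set α := √(l / n) with hα
  set γ := √(l / r) with hγ
  have hα0 : 0 < α := Real.sqrt_pos.2 (by positivity)
  have hγ0 : 0 < γ := Real.sqrt_pos.2 (by positivity)
  have hα2 : α ^ 2 = l / n := Real.sq_sqrt (by positivity)
  have hγ2 : γ ^ 2 = l / r := Real.sq_sqrt (by positivity)
  set t := w ^ 2 / n with ht
  have ht0 : 0 < t := by linarith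
  have htt : √t ^ 2 = t := Real.sq_sqrt ht0.le
  have hCt : C < √t := Real.lt_sqrt_of_sq_lt htC
  -- Otherwise lγ attains the maximum and `h2` reads √t ≤ C. Thus large t forces √(l/n) to be the
  -- dominant rate.
  have hlt : l * γ < α := by
    by_contra hge
    rw [not_lt] at hge
    rw [max_eq_right hge] at h2
    exact absurd (le_of_mul_le_mul_right h2 (by positivity)) (not_le.2 hCt)
  rw [max_eq_left hlt.le] at h2 hlam
  have hlam0 : 0 < lam := by rw [hlam]; positivity
  have hκlam : 2 * lam ≤ κ := by
    rw [hκ]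
    linarith [mul_le_mul_of_nonneg_left hs hlam0.le]
  have hκt : t ≤ κ := by
    rw [hκ]
    linarith [mul_nonneg hlam0.le (Real.sqrt_nonneg (s : ℝ))]
  have hκ0 : 0 < κ := by linarith
  have hφ0 : 0 < φ := by rw [hφ]; positivity
  -- Both 2λ and t are at most κ, and t > 1 gives φ ≤ 2t; hence λφ ≤ κ². Condition 4 therefore
  -- bounds ρ below by a multiple of α, contradicting the upper bound `h7`.
  have hone : 4 ≤ 4 * κ ^ 2 / (lam * φ) := by
    rw [le_div_iff₀ (by positivity)]
    have : lam * φ ≤ κ / 2 * (2 * κ) := by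
      gcongr
      · linarith
      · rw [hφ]; linarith
    linarith [show κ / 2 * (2 * κ) = κ ^ 2 by ring]
  have hαρ : 4 * α * (1 + C) ≤ ρ := by
    have h5 : 1 / (σ * ρ) * 4 * α ≤ 1 / (σ * (1 + C)) := le_trans (by gcongr) h4
    rw [show 1 / (σ * ρ) * 4 * α = 4 * α / (σ * ρ) by ring,
      div_le_div_iff₀ (by positivity) (by positivity)] at h5
    have h6 : σ * (4 * α * (1 + C)) ≤ σ * ρ := by linarith
    exact le_of_mul_le_mul_left h6 hσ
  have h7 : ρ ^ 2 ≤ (2 + 2 * C ^ 2) * α ^ 2 := by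
    have hγα : t * γ ^ 2 ≤ C ^ 2 * α ^ 2 := by
      have h8 : √t * γ ≤ C * α :=
        (mul_le_mul_of_nonneg_left (le_mul_of_one_le_left hγ0.le hl) (Real.sqrt_nonneg t)).trans h2
      have := pow_le_pow_left₀ (by positivity) h8 2
      rwa [mul_pow, mul_pow, htt] at this
    have e1 : ρ ^ 2 = (1 + t) * (1 / r) + (1 + 1 / r) * (1 / n) := by
      rw [hρ2, ht]; field_simp; ring
    have e2 : 1 / (r : ℝ) ≤ γ ^ 2 := by rw [hγ2]; gcongr
    have e3 : 1 / (n : ℝ) ≤ α ^ 2 := by rw [hα2]; gcongr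
    have e4 : 1 / (r : ℝ) ≤ 1 := by rw [div_le_one hr']; exact hr1
    have e5 : (1 + t) * (1 / r) ≤ 2 * t * γ ^ 2 := by
      gcongr
      linarith
    have e6 : (1 + 1 / (r : ℝ)) * (1 / n) ≤ 2 * α ^ 2 := by
      gcongr
      linarith
    rw [e1]
    linarith
  have h8 := pow_le_pow_left₀ (by positivity) hαρ 2
  have h9 : (4 * α * (1 + C)) ^ 2 ≤ (2 + 2 * C ^ 2) * α ^ 2 := h8.trans h7
  have : 0 < α ^ 2 := by positivity
  have h10 : (4 * α * (1 + C)) ^ 2 =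
      16 * α ^ 2 + 32 * (C * α ^ 2) + 16 * (C ^ 2 * α ^ 2) := by ring
  linarith [mul_nonneg hC this.le, mul_nonneg (sq_nonneg C) this.le]

/-- As s₀ ≥ 1, the ratio in condition 2 is bounded below; clearing its denominator and multiplying
by √l expresses this through t and the two rates in λ. -/
lemma sparsity_rate_le {s : ℕ} {n r l w C : ℝ} (hn : 0 < n) (hr : 0 < r) (hl : 0 < l) (hw : 0 < w)
    (hs : 1 ≤ √(s : ℝ))
    (h : ‖√(s : ℝ)‖ ≤ C * ‖max (1 / √n) (l / √r) / max (w * l / √(n * r)) (w ^ 2 / n * √(l / r))‖) :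
    √(w ^ 2 / n) * (l * √(l / r)) ≤ C * max √(l / n) (l * √(l / r)) := by
  set D := max (w * l / √(n * r)) (w ^ 2 / n * √(l / r)) with hD
  set N := max (1 / √n) (l / √r) with hN
  have hD0 : 0 < D := lt_max_of_lt_left (by positivity)
  have hN0 : 0 ≤ N := le_max_of_le_left (by positivity)
  rw [Real.norm_of_nonneg (Real.sqrt_nonneg _), Real.norm_of_nonneg (by positivity),
    ← mul_div_assoc, le_div_iff₀ hD0] at h
  have h1 : w * l / √(n * r) ≤ C * N :=
    (le_max_left _ _).trans ((le_mul_of_one_le_left hD0.le hs).trans h)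
  have h2 := mul_le_mul_of_nonneg_right h1 (Real.sqrt_nonneg l)
  rw [sqrt_mul_log_div_eq hn hl hw, mul_assoc] at h2
  refine h2.trans (le_of_eq ?_)
  rw [hN, max_mul_of_nonneg _ _ (Real.sqrt_nonneg l), Real.sqrt_div hl.le, Real.sqrt_div hl.le]
  congr 2 <;> ring

lemma shift_rate_le {s : ℕ} {n r l w c d σ ρ : ℝ} (hn : 0 < n) (hr : 0 < r) (hl : 1 ≤ l)
    (hw : 0 < w) (hσρ : 0 < σ * ρ) (hc : 0 ≤ c) (hd : 0 ≤ d) (hs : 1 ≤ √(s : ℝ))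
    (h : ‖1 / (σ * ρ) * √(s : ℝ)‖ ≤ c * ‖min d (√(n * r) / (w * l))‖) :
    √(w ^ 2 / n) * √(l / r) ≤ c * (σ * ρ) := by
  have hl0 : 0 < l := by linarith
  rw [Real.norm_of_nonneg (by positivity), Real.norm_of_nonneg (by positivity)] at h
  have h1 : 1 / (σ * ρ) ≤ c * (√(n * r) / (w * l)) :=
    (le_mul_of_one_le_right (by positivity) hs).trans (h.trans (by gcongr; exact min_le_right _ _))
  have hnr : 0 < √(n * r) := Real.sqrt_pos.2 (by positivity)
  have h2 : w * l / √(n * r) ≤ c * (σ * ρ) := by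
    rw [div_le_iff₀ hσρ] at h1
    rw [div_le_iff₀ hnr]
    have := mul_le_mul_of_nonneg_right h1 (show 0 ≤ w * l by positivity)
    calc w * l = 1 * (w * l) := by ring
      _ ≤ _ := this
      _ = _ := by field_simp
  have h3 := mul_le_mul_of_nonneg_right h2 (Real.sqrt_nonneg l)
  rw [sqrt_mul_log_div_eq hn hl0 hw] at h3
  have h4 : √l ≤ l := by
    rw [Real.sqrt_le_left hl0.le]; nlinarith
  have h5 : l * (√(w ^ 2 / n) * √(l / r)) ≤ l * (c * (σ * ρ)) := by
    have := mul_le_mul_of_nonneg_left h4 (show 0 ≤ c * (σ * ρ) by positivity)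
    linarith
  exact le_of_mul_le_mul_left h5 hl0

/-- A positive lower bound for the left side of condition 1, so that condition also forces log p / n
and log p / r to be small. -/
lemma four_div_le_kappa_ratio {n s : ℕ} {lam w K : ℝ} (hlam : 0 < lam) (hs : 1 ≤ √(s : ℝ))
    (hK : w ^ 2 / n ≤ K) :
    4 / (1 + K) ≤ kappa n s lam w ^ 2 / (lam ^ 2 * phi n w) := by
  have ht0 : 0 ≤ w ^ 2 / n := by positivity
  have hφ : 0 < phi n w := by rw [phi]; positivity
  have hφK : phi n w ≤ 1 + K := by rw [phi]; linarith
  have hκ : 2 * lam ≤ kappa n s lam w := by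
    rw [kappa]
    linarith [mul_le_mul_of_nonneg_left hs hlam.le]
  rw [div_le_div_iff₀ (by linarith) (by positivity)]
  have h1 := pow_le_pow_left₀ (by positivity) hκ 2
  calc 4 * (lam ^ 2 * phi n w) = (2 * lam) ^ 2 * phi n w := by ring
    _ ≤ _ := by gcongr

/-- The projected noise is of order √l γ, while λ contains lγ. The spare factor √l absorbs every
constant depending on K and σ, which is why the constant in λ can be absolute. -/
lemma noise_term_le_lam {σ l K n γ s : ℝ} (hσ : 0 < σ) (hl : 1 ≤ l) (hK : 0 ≤ K) (hγ : 0 ≤ γ)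
    (hlK : 36 * (2 + K) * (1 + 2 * K / σ ^ 2) ≤ l) (hs : s ≤ 6 * γ) :
    s * √(2 + K) * √(σ ^ 2 * l + 2 * K) + 3 * σ * √(l / n) ≤
      8 * σ * max √(l / n) (l * γ) / 2 := by
  have h1 : 6 * (√(2 + K) * √(σ ^ 2 * l + 2 * K)) ≤ σ * l := by
    have e : 6 * (√(2 + K) * √(σ ^ 2 * l + 2 * K)) = √(36 * ((2 + K) * (σ ^ 2 * l + 2 * K))) := by
      rw [Real.sqrt_mul (by norm_num), Real.sqrt_mul (by linarith),
        show (36 : ℝ) = 6 ^ 2 by norm_num, Real.sqrt_sq (by norm_num)]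
    rw [e, Real.sqrt_le_left (by positivity)]
    have h2 : σ ^ 2 * l + 2 * K ≤ σ ^ 2 * l * (1 + 2 * K / σ ^ 2) := by
      have : σ ^ 2 * l * (1 + 2 * K / σ ^ 2) = σ ^ 2 * l + 2 * K * l := by field_simp
      rw [this]
      nlinarith
    calc 36 * ((2 + K) * (σ ^ 2 * l + 2 * K))
        ≤ 36 * ((2 + K) * (σ ^ 2 * l * (1 + 2 * K / σ ^ 2))) := by gcongr
      _ = (36 * (2 + K) * (1 + 2 * K / σ ^ 2)) * (σ ^ 2 * l) := by ring
      _ ≤ l * (σ ^ 2 * l) := by gcongr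
      _ = (σ * l) ^ 2 := by ring
  have h3 : s * √(2 + K) * √(σ ^ 2 * l + 2 * K) ≤ σ * (l * γ) := by
    calc s * √(2 + K) * √(σ ^ 2 * l + 2 * K)
        ≤ 6 * γ * √(2 + K) * √(σ ^ 2 * l + 2 * K) := by gcongr
      _ = 6 * (√(2 + K) * √(σ ^ 2 * l + 2 * K)) * γ := by ring
      _ ≤ σ * l * γ := by gcongr
      _ = σ * (l * γ) := by ring
  have h4 := mul_le_mul_of_nonneg_left (le_max_left √(l / n) (l * γ)) hσ.le
  have h5 := mul_le_mul_of_nonneg_left (le_max_right √(l / n) (l * γ)) hσ.le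
  linarith

lemma privacyW_pos {B ε δ : ℝ} {r : ℕ} (hB : 0 < B) (hε : 0 < ε) (hδ : 0 < δ)
    (hδ1 : δ < 1 / Real.exp 1) : 0 < privacyW B ε δ r := by
  have h1 : δ < 4 := by
    have : 1 / Real.exp 1 ≤ 1 := by
      rw [div_le_one (Real.exp_pos _)]
      exact Real.one_le_exp (by norm_num)
    linarith
  have : 0 < Real.log (4 / δ) := Real.log_pos (by rw [lt_div_iff₀ hδ]; linarith)
  exact Real.sqrt_pos.2 (by positivity)

lemma one_le_sqrt_sparsity {p : ℕ} {θ₀ : Fin p → ℝ} (h : θ₀ ⬝ᵥ θ₀ = 1) :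
    1 ≤ √(sparsity θ₀ : ℝ) := by
  have : sparsity θ₀ ≠ 0 := by
    intro h0
    rw [sparsity, Set.ncard_eq_zero (Set.toFinite _)] at h0
    have hz : θ₀ = 0 := by
      ext j
      by_contra hj
      exact Set.notMem_empty j (h0 ▸ hj)
    simp [hz] at h
  rw [Real.one_le_sqrt]
  exact_mod_cast Nat.one_le_iff_ne_zero.2 this

lemma failure_probability_le {p : ℕ} (hp : 1 ≤ p) :
    (p : ℝ) ^ 2 * (2 * Real.exp (-(4 * Real.log p))) + p * (2 * Real.exp (-(2 * Real.log p))) +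
        1 / Real.log p + ((p : ℝ) ^ 2 + 2 * p) * (4 * Real.exp (-(4 * Real.log p))) ≤
      16 / p + 1 / Real.log p := by
  have hp1 : (1 : ℝ) ≤ p := by exact_mod_cast hp
  have hp0 : (0 : ℝ) < p := by linarith
  have e : ∀ m : ℕ, Real.exp (-(m * Real.log p)) = ((p : ℝ) ^ m)⁻¹ := fun m => by
    rw [Real.exp_neg, Real.exp_nat_mul, Real.exp_log hp0]
  have e2 := e 2
  have e4 := e 4
  push_cast at e2 e4
  rw [e2, e4]
  have key : (p : ℝ) ^ 2 * (2 * ((p : ℝ) ^ 4)⁻¹) + p * (2 * ((p : ℝ) ^ 2)⁻¹) +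
      ((p : ℝ) ^ 2 + 2 * p) * (4 * ((p : ℝ) ^ 4)⁻¹) ≤ 16 / p := by
    have : (p : ℝ) ^ 2 * (2 * ((p : ℝ) ^ 4)⁻¹) + p * (2 * ((p : ℝ) ^ 2)⁻¹) +
      ((p : ℝ) ^ 2 + 2 * p) * (4 * ((p : ℝ) ^ 4)⁻¹) =
        (6 * (p : ℝ) + 2 * p ^ 2 + 8) / p ^ 3 := by field_simp; ring
    rw [this, div_le_div_iff₀ (by positivity) hp0]
    nlinarith [mul_le_mul_of_nonneg_left hp1 (by positivity : (0 : ℝ) ≤ (p : ℝ)),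
      mul_le_mul_of_nonneg_left hp1 (by positivity : (0 : ℝ) ≤ (p : ℝ) ^ 2)]
  linarith

end Rates

/-! ### Assembling the bound -/

/-- On regular data, rates that are small compared with fixed constants make the bias small
compared with `σ ρ`. -/
lemma IsRegular.norm_bias_div_le {n p r : ℕ} {R : Matrix (Fin r) (Cols n p) ℝ}
    {X : Matrix (Fin n) (Fin p) ℝ} {ξ : Fin n → ℝ} {w σ b K M lam η : ℝ} {θ₀ θhat : Fin p → ℝ}
    (h : IsRegular R X ξ w σ θ₀ (Real.log p) (3 * (b ^ 2 + 1) * √(Real.log p / n))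
      √(32 * Real.log p / r))
    (hn : 0 < n) (hr : 0 < r) (hθ₀ : θ₀ ⬝ᵥ θ₀ = 1)
    (hmin : IsPrivateLasso R X (response X θ₀ ξ) w lam θhat) (hσ : 0 < σ)
    (hlam : lam = 8 * σ * lamRate n p r) (hK : w ^ 2 / n ≤ K) (hl : 1 ≤ Real.log p)
    (hlK : 36 * (2 + K) * (1 + 2 * K / σ ^ 2) ≤ Real.log p)
    (hM : M = 3 * (b ^ 2 + 1) + 6 * (2 + K))
    (hα : 3 * (b ^ 2 + 1) * √(Real.log p / n) ≤ 1)
    (hq1 : kappa n (sparsity θ₀) lam w ^ 2 / (lam ^ 2 * phi n w) * √(Real.log p / n) ≤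
      1 / (16 * M))
    (hq2 : kappa n (sparsity θ₀) lam w ^ 2 / (lam ^ 2 * phi n w) * √(Real.log p / r) ≤
      1 / (16 * M))
    (h1 : 1 / (σ * rho n r w) * (4 * kappa n (sparsity θ₀) lam w ^ 2 / (lam * phi n w)) *
      √(Real.log p / n) ≤ η / (2 * M))
    (h2 : 1 / (σ * rho n r w) * (4 * kappa n (sparsity θ₀) lam w ^ 2 / (lam * phi n w)) *
      √(Real.log p / r) ≤ η / (2 * M))
    (h3 : √(w ^ 2 / n) * √(Real.log p / r) ≤ η / (12 * √(2 + K) * √2) * (σ * rho n r w)) :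
    ‖bias R X w θ₀ θhat‖ / (σ * rho n r w) ≤ η := by
  have hn' : (0 : ℝ) < n := by exact_mod_cast hn
  have hr' : (0 : ℝ) < r := by exact_mod_cast hr
  have ht0 : 0 ≤ w ^ 2 / n := by positivity
  have hK0 : 0 ≤ K := ht0.trans hK
  have hM0 : 0 < M := by rw [hM]; positivity
  have hσρ : 0 < σ * rho n r w := mul_pos hσ (rho_pos hn hr w)
  have hφ : 0 < phi n w := by rw [phi]; positivity
  rw [lamRate_eq (by linarith)] at hlam
  set l := Real.log p
  set α := √(l / n) with hαdef
  set γ := √(l / r) with hγdef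
  have hα0 : 0 < α := Real.sqrt_pos.2 (by positivity)
  have hγ0 : 0 < γ := Real.sqrt_pos.2 (by positivity)
  have hlam0 : 0 < lam := by
    rw [hlam]
    have : 0 < max α (l * γ) := lt_max_of_lt_left hα0
    positivity
  have hs : √(32 * l / r) ≤ 6 * γ := by
    rw [mul_div_assoc, Real.sqrt_mul (by norm_num)]
    gcongr
    rw [Real.sqrt_le_left (by norm_num)]
    norm_num
  set s := √(32 * l / r)
  set κ := kappa n (sparsity θ₀) lam w
  set φ := phi n w
  set ρ := rho n r w
  have hρ0 : ρ ≠ 0 := (rho_pos hn hr w).ne'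
  have has : 3 * (b ^ 2 + 1) * α + s * (2 + K) ≤ M * (α + γ) := by
    have h4 : s * (2 + K) ≤ 6 * γ * (2 + K) := by gcongr
    have h5 : 0 ≤ 3 * (b ^ 2 + 1) * γ := by positivity
    have h6 : 0 ≤ 6 * (2 + K) * α := by positivity
    rw [hM]
    linarith
  have key := h.norm_bias_le hn hθ₀ hmin hσ (by linarith) (by positivity) hα (Real.sqrt_nonneg _)
    hlam0 hK ?_ ?_
  · rw [div_le_iff₀ hσρ]
    refine key.trans ?_
    have e1 : M * (α + γ) * (2 * κ ^ 2 / (lam * φ)) ≤ η / 2 * (σ * ρ) := by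
      have h4 := mul_le_mul_of_nonneg_right (add_le_add h1 h2) (mul_pos hσρ hM0).le
      have e2 : (1 / (σ * ρ) * (4 * κ ^ 2 / (lam * φ)) * α +
          1 / (σ * ρ) * (4 * κ ^ 2 / (lam * φ)) * γ) * (σ * ρ * M) =
          2 * (M * (α + γ) * (2 * κ ^ 2 / (lam * φ))) := by field_simp; ring
      have e3 : (η / (2 * M) + η / (2 * M)) * (σ * ρ * M) = 2 * (η / 2 * (σ * ρ)) := by
        field_simp; ring
      rw [e2, e3] at h4
      linarith
    have e4 : s * √(2 + K) * √(2 * (w ^ 2 / n)) ≤ η / 2 * (σ * ρ) := by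
      have h5 : 0 < 12 * √(2 + K) * √2 := by positivity
      rw [div_mul_eq_mul_div, le_div_iff₀ h5] at h3
      calc s * √(2 + K) * √(2 * (w ^ 2 / n)) ≤ 6 * γ * √(2 + K) * √(2 * (w ^ 2 / n)) := by gcongr
        _ = √(w ^ 2 / n) * γ * (12 * √(2 + K) * √2) / 2 := by
            rw [Real.sqrt_mul (by norm_num)]; ring
        _ ≤ _ := by linarith
    have h7 : 0 ≤ 2 * κ ^ 2 / (lam * φ) := by positivity
    have := mul_le_mul_of_nonneg_right has h7
    linarith
  -- The Gram error is at most M(α + γ), and 8M · 2/(16M) = 1 is exactly the curvature requirement.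
  · have h4 := add_le_add hq1 hq2
    rw [← mul_add, div_mul_eq_mul_div, div_le_iff₀ (by positivity)] at h4
    have h5 := mul_le_mul_of_nonneg_left h4 (show 0 ≤ 8 * M by positivity)
    have h6 := mul_le_mul_of_nonneg_right has (show 0 ≤ 8 * κ ^ 2 by positivity)
    have e : 8 * M * ((1 / (16 * M) + 1 / (16 * M)) * (lam ^ 2 * φ)) = lam ^ 2 * φ := by
      field_simp; ring
    rw [e] at h5
    linarith
  · have := noise_term_le_lam (n := n) hσ hl hK0 hγ0.le hlK hs
    rw [hlam]
    exact this

end PrivateLasso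

open PrivateLasso in
theorem mainTheorem3 :
    ∃ Clam : ℝ, 0 < Clam ∧
    ∀ (𝒟 : Measure ℝ) (b σ : ℝ), IsDesignLaw 𝒟 b → 0 < σ →
    ∀ (n p r : ℕ → ℕ),
      Tendsto n atTop atTop → Tendsto p atTop atTop → Tendsto r atTop atTop →
    -- truncation levels of the noise
    ∀ (τ : ℕ → ℝ), (∀ k, 0 < τ k) →
      τ =O[atTop] (fun k => σ * √(Real.log (n k))) →
      Tendsto (fun k => τ k / σ - √(2 * Real.log (2 * n k))) atTop atTop →
    ∀ (θ₀ : ∀ k, Fin (p k) → ℝ), (∀ k, ‖WithLp.toLp 2 (θ₀ k)‖ = 1) →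
    ∀ (s₀ : ℕ → ℕ), (∀ k, s₀ k = sparsity (θ₀ k)) →
    -- the random data
    ∀ (Ω : ℕ → Type*) [∀ k, MeasurableSpace (Ω k)] (P : ∀ k, Measure (Ω k))
      [∀ k, IsProbabilityMeasure (P k)]
      (X : ∀ k, Ω k → Matrix (Fin (n k)) (Fin (p k)) ℝ) (ξ : ∀ k, Ω k → Fin (n k) → ℝ)
      (R : ∀ k, Ω k → Matrix (Fin (r k)) (Cols (n k) (p k)) ℝ),
      (∀ k, IsSample (P k) 𝒟 σ (τ k) (X k) (ξ k) (R k)) →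
    ∀ (y : ∀ k, Ω k → Fin (n k) → ℝ), (∀ k ω, y k ω = response (X k ω) (θ₀ k) (ξ k ω)) →
    -- the inputs of the privatization algorithm and the resulting `w`
    ∀ (B ε δ : ℕ → ℝ), (∀ k, 0 < B k) → (∀ k, ∀ᵐ ω ∂P k, RowBound (X k ω) (y k ω) (B k)) →
      (∀ k, 0 < ε k) → (∀ k, 0 < δ k ∧ δ k < 1 / Real.exp 1) →
    ∀ (w : ℕ → ℝ), (∀ k, w k = privacyW (B k) (ε k) (δ k) (r k)) →
    ∀ (lam : ℕ → ℝ), (∀ k, lam k = Clam * σ * lamRate (n k) (p k) (r k)) →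
    ∀ (ρ φ κ : ℕ → ℝ), (∀ k, ρ k = rho (n k) (r k) (w k)) → (∀ k, φ k = phi (n k) (w k)) →
      (∀ k, κ k = kappa (n k) (s₀ k) (lam k) (w k)) →
    -- any version of the private Lasso estimate
    ∀ (θhat : ∀ k, Ω k → Fin (p k) → ℝ),
      (∀ k, ∀ᵐ ω ∂P k,
        IsPrivateLasso (R k ω) (X k ω) (y k ω) (w k) (lam k) (θhat k ω)) →
    -- the four rate conditions
      (fun k => κ k ^ 2 / (lam k ^ 2 * φ k)) =o[atTop]
        (fun k => √(n k / Real.log (p k)) *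
          min 1 (min √((r k : ℝ) / n k) (√((r k : ℝ) * n k) / w k ^ 2))) →
      (fun k => √(s₀ k : ℝ)) =O[atTop]
        (fun k => max (1 / √(n k : ℝ)) (Real.log (p k) / √(r k : ℝ)) /
          max (w k * Real.log (p k) / √((n k : ℝ) * r k))
            (w k ^ 2 / n k * √(Real.log (p k) / r k))) →
      (fun k => 1 / (σ * ρ k) * √(s₀ k : ℝ)) =o[atTop]
        (fun k => min (n k / w k ^ 2 * √(r k / Real.log (p k)))
          (√((n k : ℝ) * r k) / (w k * Real.log (p k)))) →
      (fun k => 1 / (σ * ρ k) * (4 * κ k ^ 2 / (lam k * φ k))) =o[atTop]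
        (fun k => min √(n k / Real.log (p k)) (min √(r k / Real.log (p k))
          (min (n k / w k ^ 2 * √(r k / Real.log (p k)))
            (√((n k : ℝ) * r k) / (w k * Real.log (p k)))))) →
    -- `‖Δ‖∞ = oₚ(σ ρₙ)`; the norm on `Fin (p k) → ℝ` is the max norm
    ∀ η : ℝ, 0 < η →
      Tendsto (fun k => P k {ω | η < ‖bias (R k ω) (X k ω) (w k) (θ₀ k) (θhat k ω)‖ / (σ * ρ k)})
        atTop (𝓝 0) := by

  -- Half of λ must cover 3σ√(l/n) from the cross term and σlγ from the projected noise: 3 + 1 =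
  -- 8/2.
  refine ⟨8, by norm_num, ?_⟩
  intro 𝒟 b σ h𝒟 hσ n p r hn hp hr τ hτ _ _ θ₀ hθ₀ s₀ hs₀ Ω _ P _ X ξ R hS y hy B ε δ hB _ hε hδ w hw
    lam hlam ρ φ κ hρ hφ hκ θhat hθhat hC1 hC2 hC3 hC4 η hη
  obtain rfl : ρ = fun k => rho (n k) (r k) (w k) := funext hρ
  obtain rfl : φ = fun k => phi (n k) (w k) := funext hφ
  obtain rfl : κ = fun k => kappa (n k) (s₀ k) (lam k) (w k) := funext hκ
  obtain rfl : s₀ = fun k => sparsity (θ₀ k) := funext hs₀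
  have hdot : ∀ k, θ₀ k ⬝ᵥ θ₀ k = 1 := fun k => by
    rw [← norm_toLp_two_sq, hθ₀ k, one_pow]
  have hs1 : ∀ k, 1 ≤ √(sparsity (θ₀ k) : ℝ) := fun k => one_le_sqrt_sparsity (hdot k)
  have hw0 : ∀ k, 0 < w k := fun k => by
    rw [hw k]; exact privacyW_pos (hB k) (hε k) (hδ k).1 (hδ k).2
  have hL : Tendsto (fun k => Real.log (p k)) atTop atTop :=
    Real.tendsto_log_atTop.comp (tendsto_natCast_atTop_atTop.comp hp)
  have hn0 : ∀ᶠ k in atTop, 0 < n k := hn.eventually_gt_atTop 0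
  have hr0 : ∀ᶠ k in atTop, 0 < r k := hr.eventually_gt_atTop 0
  have hp0 : ∀ᶠ k in atTop, 1 ≤ p k := hp.eventually_ge_atTop 1
  have hL1 : ∀ᶠ k in atTop, 1 ≤ Real.log (p k) := hL.eventually_ge_atTop 1
  obtain ⟨C, hC0, hC2'⟩ := hC2.exists_nonneg
  set K := max 1 (C ^ 2) with hKdef
  have hK0 : 0 ≤ K := le_max_of_le_left zero_le_one
  have hK : ∀ᶠ k in atTop, w k ^ 2 / n k ≤ K := by
    filter_upwards [hn0, hr0, hL1, hC2'.bound,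
      hC4.def (show 0 < 1 / (σ * (1 + C)) by positivity)] with k hnk hrk hLk h2 h4
    have hn' : (0 : ℝ) < n k := by exact_mod_cast hnk
    have hr' : (0 : ℝ) < r k := by exact_mod_cast hrk
    have hl' : 0 < Real.log (p k) := by linarith
    have hwk := hw0 k
    exact noise_level_le hnk hrk hLk (hs1 k) hwk hσ hC0 (hlam k)
      (sparsity_rate_le hn' hr' hl' hwk (hs1 k) h2)
      (linear_rate_le hn' hr' hl' (by positivity) (by positivity) h4).1
  set M := 3 * (b ^ 2 + 1) + 6 * (2 + K) with hM
  have hM0 : 0 < M := by positivity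
  -- The first entry serves the curvature requirement. The second, through the lower bound 4/(1+K)
  -- of the ratio, makes the Gram error at most 1 and √(32 log p / r) at most 1/2.
  set c := min (1 / (16 * M)) (4 / (1 + K) * min (1 / (3 * (b ^ 2 + 1))) (1 / 12)) with hc
  have hc0 : 0 < c := by positivity
  have hbound : ∀ᶠ k in atTop,
      P k {ω | η < ‖bias (R k ω) (X k ω) (w k) (θ₀ k) (θhat k ω)‖ / (σ * rho (n k) (r k) (w k))} ≤
        ENNReal.ofReal (16 / p k + 1 / Real.log (p k)) := by
    filter_upwards [hn0, hr0, hp0, hL1, hK, hC1.def hc0,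
      hC3.def (show 0 < η / (12 * √(2 + K) * √2) by positivity),
      hC4.def (show 0 < η / (2 * M) by positivity),
      hL.eventually_ge_atTop (36 * (2 + K) * (1 + 2 * K / σ ^ 2))] with
      k hnk hrk hpk hLk hKk h1 h3 h4 hLK
    have hn' : (0 : ℝ) < n k := by exact_mod_cast hnk
    have hr' : (0 : ℝ) < r k := by exact_mod_cast hrk
    have hl' : 0 < Real.log (p k) := by linarith
    have hwk := hw0 k
    have hσρ : 0 < σ * rho (n k) (r k) (w k) := mul_pos hσ (rho_pos hnk hrk (w k))
    have hlam0 : 0 < lam k := by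
      rw [hlam k, lamRate]
      have : 0 < max √(Real.log (p k) / n k) √(Real.log (p k) ^ 3 / r k) :=
        lt_max_of_lt_left (Real.sqrt_pos.2 (by positivity))
      positivity
    obtain ⟨q1, q2⟩ := quadratic_rate_le hn' hr' hl' hc0.le h1
    obtain ⟨b1, b2⟩ := linear_rate_le hn' hr' hl' (by positivity) (by positivity) h4
    have b3 := shift_rate_le hn' hr' hLk hwk hσρ (by positivity) (by positivity) (hs1 k) h3
    have hratio := four_div_le_kappa_ratio (n := n k) hlam0 (hs1 k) hKk
    have h4K : 0 < 4 / (1 + K) := by positivity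
    have hα : √(Real.log (p k) / n k) ≤ 1 / (3 * (b ^ 2 + 1)) := by
      refine le_of_mul_le_mul_left ?_ h4K
      calc 4 / (1 + K) * √(Real.log (p k) / n k) ≤ c :=
            (mul_le_mul_of_nonneg_right hratio (Real.sqrt_nonneg _)).trans q1
        _ ≤ _ := (min_le_right _ _).trans (by gcongr; exact min_le_left _ _)
    have hγ : √(Real.log (p k) / r k) ≤ 1 / 12 := by
      refine le_of_mul_le_mul_left ?_ h4K
      calc 4 / (1 + K) * √(Real.log (p k) / r k) ≤ c :=
            (mul_le_mul_of_nonneg_right hratio (Real.sqrt_nonneg _)).trans q2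
        _ ≤ _ := (min_le_right _ _).trans (by gcongr; exact min_le_right _ _)
    have hs : √(32 * Real.log (p k) / r k) ≤ 1 / 2 := by
      rw [mul_div_assoc, Real.sqrt_mul (by norm_num)]
      have : √(32 : ℝ) ≤ 6 := by
        rw [Real.sqrt_le_left (by norm_num)]; norm_num
      calc √32 * √(Real.log (p k) / r k) ≤ 6 * (1 / 12) := by gcongr
        _ = 1 / 2 := by norm_num
    have hreg := measureReal_not_isRegular_le hnk hrk h𝒟 hσ (hτ k) (hS k) (w k) (θ₀ k) hl' hs
    have hle : P k {ω | ¬ IsRegular (R k ω) (X k ω) (ξ k ω) (w k) σ (θ₀ k) (Real.log (p k))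
        (3 * (b ^ 2 + 1) * √(Real.log (p k) / n k)) √(32 * Real.log (p k) / r k)} ≤
        ENNReal.ofReal (16 / p k + 1 / Real.log (p k)) := by
      rw [← ENNReal.ofReal_toReal (measure_ne_top (P k) _)]
      exact ENNReal.ofReal_le_ofReal (hreg.trans (failure_probability_le hpk))
    -- Almost-everywhere inclusion in the irregular event suffices, so θhat need not be measurable.
    refine le_trans (measure_mono_ae ?_) hle
    filter_upwards [hθhat k] with ω hω hbad hgood
    rw [hy k ω] at hω
    refine absurd (show η < _ from hbad) (not_lt.2 (hgood.norm_bias_div_le hnk hrk (hdot k) hω hσ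
      (hlam k) hKk hLk hLK hM ?_ (q1.trans (min_le_left _ _)) (q2.trans (min_le_left _ _)) b1 b2 b3))
    rw [le_div_iff₀ (by positivity)] at hα
    linarith
  have hlim : Tendsto (fun k => ENNReal.ofReal (16 / p k + 1 / Real.log (p k))) atTop (𝓝 0) := by
    rw [← ENNReal.ofReal_zero]
    refine (ENNReal.continuous_ofReal.tendsto 0).comp ?_
    have h1 : Tendsto (fun k => (16 : ℝ) / p k) atTop (𝓝 0) :=
      (tendsto_natCast_atTop_atTop.comp hp).const_div_atTop 16
    have h2 : Tendsto (fun k => 1 / Real.log (p k)) atTop (𝓝 0) := hL.const_div_atTop 1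
    simpa using h1.add h2
  exact tendsto_of_tendsto_of_tendsto_of_le_of_le' tendsto_const_nhds hlim
    (Eventually.of_forall fun _ => zero_le) hbound
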